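/- For a finite Borel measure $\mu$ on $\mathbb{R}$ and $f\in L^2(\mu)$ write $\widehat{f\,d\mu}(\xi)=\int e^{-2\pi i x\xi}f(x)\,d\mu(x)$ and $\widehat{\mu}=\widehat{1\,d\mu}$. Let $\alpha\in(0,1)$ be of the form $\alpha=\frac{\log t_0}{\log n_0}$ with $t_0,n_0\in\mathbb{N}$, $n_0\neq 1$, and let $1\le p<\frac4\alpha-2$. Then there are a Borel probability measure $\mu$ on $[0,1]$, supported on a compact set $E\subseteq[0,1]$ of Hausdorff dimension $\alpha$ (that is, $\mu(\mathbb{R}\setminus E)=0$), and a sequence of functions $f_\ell=\mathbf 1_{F_\ell}$, $\ell\in\mathbb{N}$, where each $F_\ell\subseteq[0,1]$ is a finite union of intervals and $\|f_\ell\|_{L^2(\mu)}>0$, such that: 1. there is a constant $C$ with $\mu(B(x,r))\le C r^{\alpha}$ for all $x\in\mathbb{R}$ and $r>0$; 2. for every $\beta<\alpha$ there is a constant $C_\beta$ with $|\widehat{\mu}(\xi)|\le C_\beta(1+|\xi|)^{-\beta/2}$ for all $\xi\in\mathbb{R}$; 3. $\displaystyle\frac{\|\widehat{f_\ell\,d\mu}\|_{L^p(\mathbb{R})}}{\|f_\ell\|_{L^2(\mu)}}\to\infty$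 as $\ell\to\infty$ (the ratio taking values in $[0,\infty]$). In particular, there is no finite constant $C$ such that $\|\widehat{f\,d\mu}\|_{L^p(\mathbb{R})}\le C\|f\|_{L^2(\mu)}$ for all $f\in L^2(\mu)$. -/

import Mathlib

open MeasureTheory Filter Topology
open scoped ENNReal NNReal

/-- The Fourier transform `ξ ↦ ∫ exp(-2πi x ξ) f(x) dμ(x)` of the complex measure `f dμ` on `ℝ`. -/
noncomputable def measureFourier (μ : Measure ℝ) (f : ℝ → ℂ) : ℝ → ℂ :=
  Fourier.fourierIntegral Real.fourierChar μ f

theorem measureFourier_apply (μ : Measure ℝ) (f : ℝ → ℂ) (ξ : ℝ) :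
    measureFourier μ f ξ
      = ∫ x, Complex.exp (-(2 * Real.pi * (x : ℂ) * (ξ : ℂ) * Complex.I)) * f x ∂μ := by
  unfold measureFourier
  rw [Fourier.fourierIntegral_def]
  refine integral_congr_ae (Eventually.of_forall fun x => ?_)
  simp only [Circle.smul_def, Real.fourierChar_apply, smul_eq_mul]
  congr 2
  push_cast
  ring

/-- The ball condition `μ(B(x,r)) ≤ C r^α` for all `x ∈ ℝ` and `r > 0`, with some constant `C`. -/
def BallCondition (μ : Measure ℝ) (α : ℝ) : Prop :=
  ∃ C : ℝ, ∀ x r : ℝ, 0 < r → μ (Metric.closedBall x r) ≤ ENNReal.ofReal (C * r ^ α)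

/-- The Fourier decay `|μ̂(ξ)| ≤ C (1 + |ξ|)^{-β/2}` for all `ξ ∈ ℝ`, with some constant `C`. -/
def FourierDecay (μ : Measure ℝ) (β : ℝ) : Prop :=
  ∃ C : ℝ, ∀ ξ : ℝ, ‖measureFourier μ (fun _ => 1) ξ‖ ≤ C * (1 + |ξ|) ^ (-β / 2)

/-- `F` is a union of finitely many intervals (open, closed, half-open). -/
def IsFiniteUnionOfIntervals (F : Set ℝ) : Prop :=
  ∃ S : Set (Set ℝ), S.Finite ∧ (∀ I ∈ S, I.OrdConnected) ∧ F = ⋃₀ S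

/-- The restriction estimate `‖(f dμ)^‖_{L^p(ℝ)} ≤ C ‖f‖_{L²(μ)}` for all `f ∈ L²(μ)`,
with some finite constant `C`. -/
def RestrictionEstimate (μ : Measure ℝ) (p : ℝ) : Prop :=
  ∃ C : ℝ≥0, ∀ f : ℝ → ℂ, MemLp f 2 μ →
    eLpNorm (measureFourier μ f) (ENNReal.ofReal p) volume ≤ C * eLpNorm f 2 μ

/-! Write `N` for the denominator base and `T` for the numerator base, so that `N ^ α = T`. The
measure is a weighted sum over `k` of layers. Layer `k` consists of `T ^ k` copies of a Salem
measure `ν` of dimension `α`, shrunk by `N ^ (-2k)`, each of mass `T ^ (-2k)`, based at the points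
`a / (2T) ^ k` of an arithmetic progression.

The mass of a copy is its length to the power `α`, so each layer satisfies the ball condition with a
constant independent of `k` (`layer_closedBall_le`). Each layer also inherits the Fourier decay of
`ν` uniformly in `k`, by the triangle inequality alone (`norm_integral_phase_layer_le`). Hence any
summable weights are allowed, and `c / (k+1) ^ 2` costs only a polynomial factor.

The test function is the indicator of the `k`-th progression of intervals. Near multiples of `(2T) ^
k`, within a small multiple of `2 ^ k` and up to a small multiple of `N ^ (2k)`, all its points are
in phase (`half_le_phase_re_of_mem`). So its transform is at least half its mass on a set of measure
about `(N² / T) ^ k`. Its mass is at least `w k / T ^ k`, so the ratio of norms is at least of order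
`(N² / T) ^ (k/p) T ^ (-k/2) / (k+1)`. This is exponentially large exactly when `p < 4/α - 2`
(`one_lt_growth`).

The Salem measure comes from a Cantor construction in which the children of a node are a block of
`T` cyclically consecutive digits modulo `N`, shifted separately at each node. Averaged over the
shift, the block is equidistributed among all digits. A derandomised moment argument
(`exists_selection_sum_le`) picks shifts for which every exponential sum deviates from this average
by the square root of the number of nodes, up to a factor linear in the generation. The deviations
telescope to the decay of the limit measure (`norm_limit_le_rpow`). -/

/-! ### The character `x ↦ exp(-2πi x)` -/

/-- The character `x ↦ exp(-2πi x)`. -/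
noncomputable def phase (x : ℝ) : ℂ := Complex.exp (-(2 * Real.pi * x * Complex.I))

theorem phase_eq (x : ℝ) : phase x = Complex.exp (Complex.I * ((-(2 * Real.pi * x) : ℝ) : ℂ)) := by
  unfold phase
  congr 1
  push_cast
  ring

theorem norm_phase (x : ℝ) : ‖phase x‖ = 1 := by
  rw [phase_eq, mul_comm]
  exact Complex.norm_exp_ofReal_mul_I _

theorem phase_zero : phase 0 = 1 := by simp [phase]

theorem phase_add (x y : ℝ) : phase (x + y) = phase x * phase y := by
  unfold phase
  rw [← Complex.exp_add]
  congr 1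
  push_cast
  ring

theorem phase_natCast_mul (n : ℕ) (x : ℝ) : phase (n * x) = phase x ^ n := by
  unfold phase
  rw [← Complex.exp_nat_mul]
  congr 1
  push_cast
  ring

theorem phase_intCast (n : ℤ) : phase n = 1 := by
  unfold phase
  rw [Complex.exp_eq_one_iff]
  exact ⟨-n, by push_cast; ring⟩

theorem norm_phase_sub_one_le (x : ℝ) : ‖phase x - 1‖ ≤ 2 * Real.pi * |x| := by
  rw [phase_eq]
  refine Real.norm_exp_I_mul_ofReal_sub_one_le.trans (le_of_eq ?_)
  rw [Real.norm_eq_abs, abs_neg, abs_mul, abs_of_pos Real.two_pi_pos]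

theorem norm_phase_sub_le (x y : ℝ) : ‖phase x - phase y‖ ≤ 2 * Real.pi * |x - y| := by
  have h : phase x - phase y = phase y * (phase (x - y) - 1) := by
    rw [mul_sub, ← phase_add]
    simp
  rw [h, norm_mul, norm_phase, one_mul]
  exact norm_phase_sub_one_le _

theorem continuous_phase : Continuous phase := by
  unfold phase
  fun_prop

theorem phase_re (x : ℝ) : (phase x).re = Real.cos (2 * Real.pi * x) := by
  rw [phase_eq, mul_comm, Complex.exp_ofReal_mul_I_re, Real.cos_neg]

/-! ### A selection with square-root cancellation -/

/-- Exponential moments under uniform independent choices: the average over all `V` of `∑ k, exp (t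
* ∑ u, X k u (V u))` factorises over `u` and is at most `e * card κ`. A `V` not above average bounds
every summand, and taking logarithms gives the claim. -/
theorem exists_selection_sum_le {ι Ω κ : Type*} [Fintype ι] [Fintype Ω] [Fintype κ] [Nonempty Ω]
    (X : κ → ι → Ω → ℝ) (B : ℝ) (hB : 0 < B) (h0 : ∀ k u, ∑ ω, X k u ω = 0)
    (hX : ∀ k u ω, |X k u ω| ≤ B) :
    ∃ V : ι → Ω, ∀ k, ∑ u, X k u (V u)
      ≤ B * √(Fintype.card ι) * (1 + Real.log (Fintype.card κ)) := by
  classical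
  rcases isEmpty_or_nonempty ι with hι | hι
  · exact ⟨fun _ => Classical.arbitrary Ω, fun k => by simp⟩
  have hn : (1 : ℝ) ≤ Fintype.card ι := by exact_mod_cast Fintype.card_pos
  set s : ℝ := √(Fintype.card ι) with hs
  have hs1 : 1 ≤ s := by rw [hs]; exact Real.one_le_sqrt.mpr hn
  have hss : s ^ 2 = Fintype.card ι := Real.sq_sqrt (by linarith)
  have hs0 : 0 < s := by linarith
  -- With this `t` every `|t * X|` is at most `1 / √n`, where `n = card ι`. Then `exp y ≤ 1 + y +
  -- y²` and the vanishing mean give a factor `1 + 1/n ≤ exp (1/n)` for each of the `n` indices.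
  set t : ℝ := 1 / (B * s) with ht
  have hBs : 0 < B * s := by positivity
  have ht0 : 0 < t := by positivity
  have htB : t * B = 1 / s := by rw [ht]; field_simp
  have hfac : ∀ k u, ∑ ω, Real.exp (t * X k u ω)
      ≤ Fintype.card Ω * Real.exp (1 / Fintype.card ι) := by
    intro k u
    have hterm : ∀ ω, Real.exp (t * X k u ω) ≤ 1 + t * X k u ω + 1 / Fintype.card ι := by
      intro ω
      have hab : |t * X k u ω| ≤ 1 / s := by
        rw [abs_mul, abs_of_pos ht0, ← htB]
        exact mul_le_mul_of_nonneg_left (hX k u ω) ht0.le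
      have h1s : 1 / s ≤ 1 := by rw [div_le_one hs0]; exact hs1
      have h1 := abs_le.mp (Real.abs_exp_sub_one_sub_id_le (hab.trans h1s))
      have h2 : (t * X k u ω) ^ 2 ≤ 1 / Fintype.card ι := by
        rw [← hss, ← one_div_pow, ← sq_abs]
        exact pow_le_pow_left₀ (abs_nonneg _) hab 2
      linarith [h1.2]
    calc ∑ ω, Real.exp (t * X k u ω) ≤ ∑ ω, (1 + t * X k u ω + 1 / Fintype.card ι) :=
          Finset.sum_le_sum fun ω _ => hterm ω
      _ = Fintype.card Ω * (1 / Fintype.card ι + 1) := by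
          simp only [Finset.sum_add_distrib, ← Finset.mul_sum, h0]
          simp
          ring
      _ ≤ _ := by
          gcongr
          exact Real.add_one_le_exp _
  have havg : ∑ V : ι → Ω, ∑ k, Real.exp (t * ∑ u, X k u (V u))
      ≤ ∑ _V : ι → Ω, (Fintype.card κ : ℝ) * Real.exp 1 := by
    rw [Finset.sum_comm]
    have hk : ∀ k : κ, ∑ V : ι → Ω, Real.exp (t * ∑ u, X k u (V u))
        ≤ (Fintype.card Ω : ℝ) ^ Fintype.card ι * Real.exp 1 := by
      intro k
      calc ∑ V : ι → Ω, Real.exp (t * ∑ u, X k u (V u))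
          = ∑ V : ι → Ω, ∏ u, Real.exp (t * X k u (V u)) := by
            simp only [Finset.mul_sum, Real.exp_sum]
        _ = ∏ u, ∑ ω, Real.exp (t * X k u ω) := by
            rw [Fintype.prod_sum]
        _ ≤ ∏ _u : ι, (Fintype.card Ω * Real.exp (1 / Fintype.card ι)) := by
            refine Finset.prod_le_prod (fun u _ => ?_) (fun u _ => hfac k u)
            exact Finset.sum_nonneg fun ω _ => (Real.exp_pos _).le
        _ = _ := by
            rw [Finset.prod_const, Finset.card_univ, mul_pow, ← Real.exp_nat_mul]
            congr 2
            field_simp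
    calc _ ≤ ∑ _k : κ, (Fintype.card Ω : ℝ) ^ Fintype.card ι * Real.exp 1 :=
          Finset.sum_le_sum fun k _ => hk k
      _ = _ := by
          simp
          ring
  obtain ⟨V, -, hV⟩ := Finset.exists_le_of_sum_le
    (Finset.univ_nonempty (α := ι → Ω)) havg
  refine ⟨V, fun k => ?_⟩
  have h1 : Real.exp (t * ∑ u, X k u (V u)) ≤ Fintype.card κ * Real.exp 1 :=
    (Finset.single_le_sum (f := fun k => Real.exp (t * ∑ u, X k u (V u)))
      (fun _ _ => (Real.exp_pos _).le) (Finset.mem_univ k)).trans hV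
  have hκ : (0 : ℝ) < Fintype.card κ := by
    exact_mod_cast Fintype.card_pos_iff.mpr ⟨k⟩
  have h2 := Real.log_le_log (Real.exp_pos _) h1
  rw [Real.log_exp, Real.log_mul hκ.ne' (Real.exp_pos _).ne', Real.log_exp] at h2
  have h3 : B * s * (t * ∑ u, X k u (V u)) = ∑ u, X k u (V u) := by
    rw [ht]; field_simp
  rw [← h3]
  exact mul_le_mul_of_nonneg_left (by linarith) hBs.le

theorem sum_range_add_mod {M : Type*} [AddCommMonoid M] (N i : ℕ) [NeZero N] (f : ℕ → M) :
    ∑ v ∈ Finset.range N, f ((i + v) % N) = ∑ d ∈ Finset.range N, f d := by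
  rw [← Fin.sum_univ_eq_sum_range (fun v => f ((i + v) % N)), ← Fin.sum_univ_eq_sum_range f]
  refine Fintype.sum_equiv (Equiv.addLeft (Fin.ofNat N i)) _ _ fun v => ?_
  simp [Fin.val_add]

/-- The deviation of the children of one node, shifted by `v`, from the average over all digits. -/
noncomputable def shiftDeviation (N T a v : ℕ) (θ : ℝ) : ℂ :=
  ∑ i ∈ Finset.range T, phase ((N * a + (i + v) % N : ℕ) * θ)
    - (T / N : ℂ) * ∑ d ∈ Finset.range N, phase ((N * a + d : ℕ) * θ)

/-- Over all cyclic shifts every digit is hit exactly `T` times. This is the mean-zero hypothesis of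
the selection lemma. -/
theorem sum_shiftDeviation (N T a : ℕ) [NeZero N] (θ : ℝ) :
    ∑ v ∈ Finset.range N, shiftDeviation N T a v θ = 0 := by
  have hN : (N : ℂ) ≠ 0 := Nat.cast_ne_zero.mpr (NeZero.ne N)
  unfold shiftDeviation
  rw [Finset.sum_sub_distrib, Finset.sum_comm]
  simp only [sum_range_add_mod N _ (fun d => phase ((N * a + d : ℕ) * θ)), Finset.sum_const,
    Finset.card_range, nsmul_eq_mul]
  rw [← mul_assoc, mul_div_cancel₀ _ hN, sub_self]

theorem norm_shiftDeviation_le (N T a v : ℕ) [NeZero N] (θ : ℝ) :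
    ‖shiftDeviation N T a v θ‖ ≤ 2 * T := by
  have hN : (N : ℝ) ≠ 0 := Nat.cast_ne_zero.mpr (NeZero.ne N)
  have h1 : ‖∑ i ∈ Finset.range T, phase ((N * a + (i + v) % N : ℕ) * θ)‖ ≤ T := by
    refine (norm_sum_le _ _).trans ?_
    simp [norm_phase]
  have h2 : ‖(T / N : ℂ) * ∑ d ∈ Finset.range N, phase ((N * a + d : ℕ) * θ)‖ ≤ T := by
    have : ‖∑ d ∈ Finset.range N, phase ((N * a + d : ℕ) * θ)‖ ≤ N := by
      refine (norm_sum_le _ _).trans ?_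
      simp [norm_phase]
    rw [norm_mul, norm_div, Complex.norm_natCast, Complex.norm_natCast]
    calc (T / N : ℝ) * _ ≤ T / N * N := by gcongr
      _ = T := by field_simp
  unfold shiftDeviation
  exact (norm_sub_le _ _).trans (by linarith)

theorem norm_phase_natCast_mul_sub_le (m H : ℕ) (h : m ≤ H) (θ θ' : ℝ) :
    ‖phase (m * θ) - phase (m * θ')‖ ≤ 2 * Real.pi * H * |θ - θ'| := by
  refine (norm_phase_sub_le _ _).trans ?_
  rw [← mul_sub, abs_mul, Nat.abs_cast, mul_assoc (2 * Real.pi)]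
  have : (m : ℝ) ≤ H := by exact_mod_cast h
  have := Real.pi_pos
  gcongr

theorem norm_shiftDeviation_sub_le (N T a v H : ℕ) [NeZero N] (ha : a < H) (θ θ' : ℝ) :
    ‖shiftDeviation N T a v θ - shiftDeviation N T a v θ'‖
      ≤ 4 * Real.pi * T * (N * H) * |θ - θ'| := by
  have hN : (N : ℝ) ≠ 0 := Nat.cast_ne_zero.mpr (NeZero.ne N)
  have hN0 : 0 < N := NeZero.pos N
  have hlt : ∀ d, d < N → N * a + d ≤ N * H := fun d hd => by nlinarith
  set L : ℝ := 2 * Real.pi * (N * H : ℕ) * |θ - θ'| with hL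
  have h1 : ‖∑ i ∈ Finset.range T, phase ((N * a + (i + v) % N : ℕ) * θ)
      - ∑ i ∈ Finset.range T, phase ((N * a + (i + v) % N : ℕ) * θ')‖ ≤ T * L := by
    rw [← Finset.sum_sub_distrib]
    refine (norm_sum_le _ _).trans ?_
    refine (Finset.sum_le_sum fun i _ =>
      norm_phase_natCast_mul_sub_le _ (N * H) (hlt _ (Nat.mod_lt _ hN0)) θ θ').trans ?_
    simp [hL]
  have h2 : ‖(T / N : ℂ) * ∑ d ∈ Finset.range N, phase ((N * a + d : ℕ) * θ)
      - (T / N : ℂ) * ∑ d ∈ Finset.range N, phase ((N * a + d : ℕ) * θ')‖ ≤ T * L := by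
    have : ‖∑ d ∈ Finset.range N, phase ((N * a + d : ℕ) * θ)
        - ∑ d ∈ Finset.range N, phase ((N * a + d : ℕ) * θ')‖ ≤ N * L := by
      rw [← Finset.sum_sub_distrib]
      refine (norm_sum_le _ _).trans ?_
      refine (Finset.sum_le_sum fun d hd =>
        norm_phase_natCast_mul_sub_le _ (N * H) (hlt _ (Finset.mem_range.mp hd)) θ θ').trans ?_
      simp [hL]
    rw [← mul_sub, norm_mul, norm_div, Complex.norm_natCast, Complex.norm_natCast]
    calc (T / N : ℝ) * _ ≤ T / N * (N * L) := by gcongr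
      _ = T * L := by field_simp
  unfold shiftDeviation
  rw [sub_sub_sub_comm]
  refine (norm_sub_le _ _).trans ((add_le_add h1 h2).trans (le_of_eq ?_))
  rw [hL]
  push_cast
  ring

theorem phase_natCast_mul_fract (m : ℕ) (θ : ℝ) : phase (m * Int.fract θ) = phase (m * θ) := by
  have h : (m : ℝ) * θ = m * Int.fract θ + ((m * ⌊θ⌋ : ℤ) : ℝ) := by
    push_cast
    rw [← mul_add, Int.fract_add_floor]
  rw [h, phase_add, phase_intCast, mul_one]

theorem shiftDeviation_fract (N T a v : ℕ) (θ : ℝ) :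
    shiftDeviation N T a v (Int.fract θ) = shiftDeviation N T a v θ := by
  simp only [shiftDeviation, phase_natCast_mul_fract]

/-- The selection lemma gives only one-sided bounds on real sums, so a complex sum is tested in the
four directions `I ^ s`. -/
theorem norm_le_of_re_I_pow_mul_le (z : ℂ) (b : ℝ)
    (h : ∀ s : Fin 4, (Complex.I ^ (s : ℕ) * z).re ≤ b) : ‖z‖ ≤ 2 * b := by
  have h0 := h 0
  have h1 := h 1
  have h2 := h 2
  have h3 := h 3
  simp [pow_succ] at h0 h1 h2 h3
  have hr : |z.re| ≤ b := abs_le.mpr ⟨by linarith, by linarith⟩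
  have hi : |z.im| ≤ b := abs_le.mpr ⟨by linarith, by linarith⟩
  linarith [Complex.norm_le_abs_re_add_abs_im z]

/-- The selection lemma handles finitely many tests, but `θ` is arbitrary. The deviations are
1-periodic in `θ` and Lipschitz, so it suffices to test the grid of mesh `1 / R` with `R = n * (N *
H)`. Rounding then costs `4πT` in total, and the `R` grid points in four directions enter only
through `log (4R)`. -/
theorem exists_shift (N T n H : ℕ) [NeZero N] (hT : 0 < T) (hn : 0 < n)
    (A : ℕ → ℕ) (hA : ∀ u, A u < H) :
    ∃ V : ℕ → ℕ, ∀ θ : ℝ, ‖∑ u ∈ Finset.range n, shiftDeviation N T (A u) (V u) θ‖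
      ≤ 4 * T * √n * (1 + Real.log (4 * (n * (N * H) : ℕ))) + 4 * Real.pi * T := by
  have hN0 : 0 < N := NeZero.pos N
  have hH : 0 < H := (Nat.zero_le _).trans_lt (hA 0)
  set R : ℕ := n * (N * H) with hR
  have hR0 : 0 < R := by positivity
  have hT' : (0 : ℝ) < T := by exact_mod_cast hT
  obtain ⟨V, hV⟩ := exists_selection_sum_le (ι := Fin n) (Ω := Fin N) (κ := Fin R × Fin 4)
    (fun k u v => (Complex.I ^ (k.2 : ℕ) * shiftDeviation N T (A u) v ((k.1 : ℕ) / R)).re)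
    (2 * T) (by positivity)
    (by
      intro k u
      rw [← Complex.re_sum, ← Finset.mul_sum,
        Fin.sum_univ_eq_sum_range (fun v => shiftDeviation N T (A u) v ((k.1 : ℕ) / R)),
        sum_shiftDeviation]
      simp)
    (by
      intro k u v
      refine (Complex.abs_re_le_norm _).trans ?_
      rw [norm_mul, norm_pow, Complex.norm_I, one_pow, one_mul]
      exact norm_shiftDeviation_le ..)
  refine ⟨fun u => if h : u < n then V ⟨u, h⟩ else 0, fun θ => ?_⟩
  have hsum : ∀ θ : ℝ, ∑ u ∈ Finset.range n,
      shiftDeviation N T (A u) ((if h : u < n then V ⟨u, h⟩ else 0 : ℕ)) θ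
      = ∑ u : Fin n, shiftDeviation N T (A u) (V u) θ := by
    intro θ
    rw [← Fin.sum_univ_eq_sum_range
      (fun u => shiftDeviation N T (A u) ((if h : u < n then V ⟨u, h⟩ else 0 : ℕ)) θ)]
    simp
  rw [hsum]
  have hRR : (0 : ℝ) < R := by exact_mod_cast hR0
  set x := Int.fract θ with hx
  have hx0 : 0 ≤ x := Int.fract_nonneg θ
  have hx1 : x < 1 := Int.fract_lt_one θ
  set k : ℕ := ⌊R * x⌋₊ with hk
  have hkR : k < R := by
    rw [hk, Nat.floor_lt (by positivity)]
    nlinarith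
  have hk1 : (k : ℝ) ≤ R * x := Nat.floor_le (by positivity)
  have hk2 : R * x < k + 1 := Nat.lt_floor_add_one _
  have hdist : |x - k / R| ≤ 1 / R := by
    have : x - k / R = (R * x - k) / R := by field_simp
    rw [this, abs_of_nonneg (div_nonneg (by linarith) hRR.le)]
    gcongr
    linarith
  have hgrid : ‖∑ u : Fin n, shiftDeviation N T (A u) (V u) (k / R)‖
      ≤ 2 * (2 * T * √n * (1 + Real.log (4 * R))) := by
    refine norm_le_of_re_I_pow_mul_le _ _ fun s => ?_
    have := hV (⟨k, hkR⟩, s)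
    simp only [Fintype.card_fin, Fintype.card_prod] at this
    rw [Finset.mul_sum, Complex.re_sum]
    refine this.trans (le_of_eq ?_)
    push_cast
    rw [mul_comm (R : ℝ) 4]
  have hdiff : ‖∑ u : Fin n, shiftDeviation N T (A u) (V u) θ
      - ∑ u : Fin n, shiftDeviation N T (A u) (V u) (k / R)‖ ≤ 4 * Real.pi * T := by
    rw [← Finset.sum_sub_distrib]
    refine (norm_sum_le _ _).trans ?_
    calc ∑ u : Fin n, ‖shiftDeviation N T (A u) (V u) θ - shiftDeviation N T (A u) (V u) (k / R)‖
        ≤ ∑ _u : Fin n, 4 * Real.pi * T * (N * H) * (1 / R) := by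
          refine Finset.sum_le_sum fun u _ => ?_
          rw [← shiftDeviation_fract]
          refine (norm_shiftDeviation_sub_le N T _ _ H (hA u) _ _).trans ?_
          gcongr
      _ = 4 * Real.pi * T := by
          simp only [Finset.sum_const, Finset.card_univ, Fintype.card_fin, nsmul_eq_mul]
          have : (R : ℝ) = n * (N * H) := by rw [hR]; push_cast; ring
          rw [this] at hRR ⊢
          field_simp
  have := norm_add_le (∑ u : Fin n, shiftDeviation N T (A u) (V u) θ
      - ∑ u : Fin n, shiftDeviation N T (A u) (V u) (k / R))
      (∑ u : Fin n, shiftDeviation N T (A u) (V u) (k / R))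
  rw [sub_add_cancel] at this
  linarith

/-! ### Digit trees -/

theorem sum_range_mul_eq {M : Type*} [AddCommMonoid M] (n T : ℕ) (f : ℕ → M) :
    ∑ u ∈ Finset.range (n * T), f u
      = ∑ u ∈ Finset.range n, ∑ i ∈ Finset.range T, f (u * T + i) := by
  induction n with
  | zero => simp
  | succ n ih =>
    rw [Finset.sum_range_succ, ← ih, Nat.succ_mul, Finset.sum_range_add]

/-- A tree of `N`-adic intervals in which every node has `T` children: `pos j u / N ^ j` is the left
endpoint of the interval of generation `j` with address `u < T ^ j`. -/
structure DigitTree (N T : ℕ) where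
  /-- The position of the interval of the given generation and address. -/
  pos : ℕ → ℕ → ℕ
  pos_zero : ∀ u, pos 0 u = 0
  pos_succ_div : ∀ j u, pos (j + 1) u / N = pos j (u / T)
  pos_injOn : ∀ j, Set.InjOn (pos j) (Set.Iio (T ^ j))

/-- The exponential sum over the intervals of generation `j`. -/
noncomputable def DigitTree.expSum {N T : ℕ} (D : DigitTree N T) (j : ℕ) (θ : ℝ) : ℂ :=
  ∑ u ∈ Finset.range (T ^ j), phase (D.pos j u * θ)

/-- The positions built from a choice of shifts depending on the previous generation. -/
def shiftedPos (N T : ℕ) (V : ℕ → (ℕ → ℕ) → ℕ → ℕ) : ℕ → ℕ → ℕ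
  | 0 => fun _ => 0
  | j + 1 => fun u =>
    N * shiftedPos N T V j (u / T) + (u % T + V j (shiftedPos N T V j) (u / T)) % N

theorem shiftedPos_lt (N T : ℕ) (hN : 0 < N) (V : ℕ → (ℕ → ℕ) → ℕ → ℕ) (j u : ℕ) :
    shiftedPos N T V j u < N ^ j := by
  induction j generalizing u with
  | zero => simp [shiftedPos]
  | succ j ih =>
    have h1 := ih (u / T)
    have h2 := Nat.mod_lt (u % T + V j (shiftedPos N T V j) (u / T)) hN
    simp only [shiftedPos]
    calc _ < N * shiftedPos N T V j (u / T) + N := by omega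
      _ = N * (shiftedPos N T V j (u / T) + 1) := by ring
      _ ≤ N * N ^ j := Nat.mul_le_mul_left _ h1
      _ = N ^ (j + 1) := by ring

/-- The digit tree built from a choice of shifts. -/
def shiftedTree (N T : ℕ) (hT : 0 < T) (hTN : T < N) (V : ℕ → (ℕ → ℕ) → ℕ → ℕ) :
    DigitTree N T where
  pos := shiftedPos N T V
  pos_zero _ := rfl
  pos_succ_div j u := by
    have hN : 0 < N := hT.trans hTN
    simp only [shiftedPos]
    rw [Nat.mul_add_div hN, Nat.div_eq_of_lt (Nat.mod_lt _ hN), add_zero]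
  pos_injOn j := by
    have hN : 0 < N := hT.trans hTN
    induction j with
    | zero =>
      intro u hu v hv _
      simp at hu hv
      omega
    | succ j ih =>
      intro u hu v hv huv
      simp only [Set.mem_Iio, pow_succ] at hu hv
      simp only [shiftedPos] at huv
      have hdiv := congrArg (· / N) huv
      simp only [Nat.mul_add_div hN, Nat.div_eq_of_lt (Nat.mod_lt _ hN), add_zero] at hdiv
      have hq : u / T = v / T :=
        ih (Nat.div_lt_of_lt_mul (by rwa [mul_comm])) (Nat.div_lt_of_lt_mul (by rwa [mul_comm])) hdiv
      rw [hq] at huv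
      -- A common shift preserves distinctness modulo `N`, and `T < N` makes the unshifted digits
      -- distinct residues.
      have hm : u % T ≡ v % T [MOD N] := Nat.ModEq.add_right_cancel' _ (Nat.add_left_cancel huv)
      have hr : u % T = v % T :=
        Nat.ModEq.eq_of_lt_of_lt hm ((Nat.mod_lt _ hT).trans hTN) ((Nat.mod_lt _ hT).trans hTN)
      rw [← Nat.div_add_mod u T, ← Nat.div_add_mod v T, hq, hr]

theorem exists_digitTree (N T : ℕ) (hT : 0 < T) (hTN : T < N) :
    ∃ (D : DigitTree N T) (C : ℝ), ∀ (j : ℕ) (θ : ℝ),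
      ‖D.expSum (j + 1) θ
        - (T / N : ℂ) * (D.expSum j (N * θ) * ∑ d ∈ Finset.range N, phase (d * θ))‖
        ≤ C * (j + 1) * T * √(T ^ j : ℕ) := by
  have hN : 0 < N := hT.trans hTN
  have : NeZero N := ⟨hN.ne'⟩
  -- The bound on `A` sits behind the existential, so that `choose` yields shifts defined for every
  -- `A`. The recursion `shiftedPos` can then use them before its positions are known to be bounded.
  have key : ∀ (j : ℕ) (A : ℕ → ℕ), ∃ V : ℕ → ℕ, (∀ u, A u < N ^ j) → ∀ θ : ℝ,
      ‖∑ u ∈ Finset.range (T ^ j), shiftDeviation N T (A u) (V u) θ‖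
      ≤ 4 * T * √(T ^ j : ℕ) * (1 + Real.log (4 * (T ^ j * (N * N ^ j) : ℕ)))
        + 4 * Real.pi * T := by
    intro j A
    by_cases hA : ∀ u, A u < N ^ j
    · obtain ⟨V, hV⟩ := exists_shift N T (T ^ j) (N ^ j) hT (by positivity) A hA
      exact ⟨V, fun _ => hV⟩
    · exact ⟨0, fun h => absurd h hA⟩
  choose V hV using key
  refine ⟨shiftedTree N T hT hTN V, 4 * (1 + Real.log 4 + 2 * Real.log N) + 4 * Real.pi,
    fun j θ => ?_⟩
  set A := shiftedPos N T V with hA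
  -- The error is exactly a sum of node deviations: a child sits at `N * a + d`, so summing over all
  -- digits `d` factors into the parent sum at `N * θ` times the digit sum.
  have h1 : (shiftedTree N T hT hTN V).expSum (j + 1) θ
        - (T / N : ℂ) * ((shiftedTree N T hT hTN V).expSum j (N * θ)
          * ∑ d ∈ Finset.range N, phase (d * θ))
      = ∑ u ∈ Finset.range (T ^ j), shiftDeviation N T (A j u) (V j (A j) u) θ := by
    simp only [shiftDeviation, Finset.sum_sub_distrib, DigitTree.expSum, shiftedTree]
    congr 1
    · rw [pow_succ, sum_range_mul_eq]
      refine Finset.sum_congr rfl fun u _ => Finset.sum_congr rfl fun i hi => ?_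
      have hi' := Finset.mem_range.mp hi
      have e1 : (u * T + i) / T = u := by
        rw [mul_comm, Nat.mul_add_div hT, Nat.div_eq_of_lt hi', add_zero]
      have e2 : (u * T + i) % T = i := by
        rw [mul_comm, Nat.mul_add_mod, Nat.mod_eq_of_lt hi']
      simp only [shiftedPos, e1, e2, hA]
    · rw [Finset.sum_mul, Finset.mul_sum]
      refine Finset.sum_congr rfl fun u _ => ?_
      rw [Finset.mul_sum]
      congr 1
      refine Finset.sum_congr rfl fun d _ => ?_
      rw [← phase_add, hA]
      congr 1
      push_cast
      ring
  rw [h1]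
  refine (hV j (A j) (fun u => shiftedPos_lt N T hN V j u) θ).trans ?_
  have hT1 : (1 : ℝ) ≤ T := by exact_mod_cast hT
  have hN1 : (1 : ℝ) ≤ N := by exact_mod_cast hN
  have hTN' : (T : ℝ) ≤ N := by exact_mod_cast hTN.le
  have hlogN : 0 ≤ Real.log N := Real.log_nonneg hN1
  have hlog4 : 0 ≤ Real.log 4 := Real.log_nonneg (by norm_num)
  have hlog : Real.log (4 * (T ^ j * (N * N ^ j) : ℕ)) ≤ Real.log 4 + (2 * j + 1) * Real.log N := by
    push_cast
    rw [Real.log_mul (by norm_num) (by positivity), Real.log_mul (by positivity) (by positivity),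
      Real.log_mul (by positivity) (by positivity), Real.log_pow, Real.log_pow]
    have : Real.log T ≤ Real.log N := Real.log_le_log (by positivity) hTN'
    have hj : (0 : ℝ) ≤ j := Nat.cast_nonneg j
    nlinarith
  have hs1 : 1 ≤ √(T ^ j : ℕ) := by
    refine Real.one_le_sqrt.mpr ?_
    exact_mod_cast Nat.one_le_pow _ _ hT
  set s := √(T ^ j : ℕ)
  have hj : (0 : ℝ) ≤ j := Nat.cast_nonneg j
  have hpi := Real.pi_pos
  have hfirst : 4 * T * s * (1 + Real.log (4 * (T ^ j * (N * N ^ j) : ℕ)))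
      ≤ 4 * T * s * ((1 + Real.log 4 + 2 * Real.log N) * (j + 1)) := by
    gcongr
    nlinarith
  have hsecond : 4 * Real.pi * T ≤ 4 * Real.pi * T * ((j + 1) * s) := by
    refine le_mul_of_one_le_right (by positivity) ?_
    nlinarith
  refine (add_le_add hfirst hsecond).trans (le_of_eq ?_)
  ring

/-! ### The Fourier transform of the unit interval -/

/-- The Fourier transform of Lebesgue measure on `[0, 1]`, away from the origin. -/
noncomputable def sincPhase (θ : ℝ) : ℂ := (1 - phase θ) / (2 * Real.pi * θ * Complex.I)

/-- The unit interval is a union of `N` translates of its `1/N`-scaled copy. This identity lets the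
main terms of consecutive generations cancel. -/
theorem sincPhase_natCast_mul (N : ℕ) (hN : 0 < N) (θ : ℝ) :
    sincPhase (N * θ)
      = (1 / N : ℂ) * (∑ d ∈ Finset.range N, phase (d * θ)) * sincPhase θ := by
  have hN' : (N : ℂ) ≠ 0 := Nat.cast_ne_zero.mpr hN.ne'
  have hgeom : (∑ d ∈ Finset.range N, phase (d * θ)) * (1 - phase θ) = 1 - phase (N * θ) := by
    simp only [phase_natCast_mul]
    exact geom_sum_mul_neg _ _
  unfold sincPhase
  rw [← hgeom]
  generalize ∑ d ∈ Finset.range N, phase (d * θ) = G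
  push_cast
  -- At the origin both sides are `0`, by the convention for division by zero.
  rcases eq_or_ne θ 0 with rfl | hθ
  · simp
  have hθ' : (θ : ℂ) ≠ 0 := by exact_mod_cast hθ
  have hpi : (Real.pi : ℂ) ≠ 0 := by exact_mod_cast Real.pi_ne_zero
  field_simp

theorem norm_sincPhase (θ : ℝ) : ‖sincPhase θ‖ = ‖phase θ - 1‖ / (2 * Real.pi * |θ|) := by
  unfold sincPhase
  rw [norm_div, norm_sub_rev]
  simp [abs_of_pos Real.pi_pos]

/-- This interpolates between the bound `1` near the origin and the bound `1 / |θ|` away from it. -/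
theorem norm_sincPhase_le_rpow (θ γ : ℝ) (hθ : θ ≠ 0) (hγ0 : 0 ≤ γ) (hγ1 : γ ≤ 1) :
    ‖sincPhase θ‖ ≤ |θ| ^ (-γ) := by
  have hpos : 0 < |θ| := abs_pos.mpr hθ
  have hpi := Real.pi_gt_three
  rw [norm_sincPhase]
  rcases le_total |θ| 1 with h | h
  · calc _ ≤ 2 * Real.pi * |θ| / (2 * Real.pi * |θ|) := by
          gcongr; exact norm_phase_sub_one_le θ
      _ = 1 := div_self (by positivity)
      _ ≤ _ := Real.one_le_rpow_of_pos_of_le_one_of_nonpos hpos h (by linarith)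
  · have h2 : ‖phase θ - 1‖ ≤ 2 := by
      refine (norm_sub_le _ _).trans ?_
      rw [norm_phase, norm_one]; norm_num
    calc _ ≤ 2 / (2 * Real.pi * |θ|) := by gcongr
      _ ≤ 1 / |θ| := by
          rw [div_le_div_iff₀ (by positivity) hpos]
          nlinarith
      _ = |θ| ^ (-1 : ℝ) := by rw [Real.rpow_neg_one, one_div]
      _ ≤ _ := Real.rpow_le_rpow_of_exponent_le h (by linarith)

theorem norm_sincPhase_sub_one_le (θ : ℝ) (h0 : θ ≠ 0) (h : 2 * Real.pi * |θ| ≤ 1) :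
    ‖sincPhase θ - 1‖ ≤ 2 * Real.pi * |θ| := by
  set x : ℂ := -(2 * Real.pi * θ * Complex.I) with hx
  have hxn : ‖x‖ = 2 * Real.pi * |θ| := by simp [hx, abs_of_pos Real.pi_pos]
  have hθ' : (θ : ℂ) ≠ 0 := by exact_mod_cast h0
  have hpi : (Real.pi : ℂ) ≠ 0 := by exact_mod_cast Real.pi_ne_zero
  have hx0 : x ≠ 0 := by simp [hx, hpi, hθ']
  have heq : sincPhase θ - 1 = (Complex.exp x - 1 - x) / x := by
    have : sincPhase θ = (Complex.exp x - 1) / x := by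
      unfold sincPhase phase
      rw [← hx, div_eq_div_iff (by simp [hpi, hθ']) hx0, hx]
      ring
    rw [this]
    field_simp
  have hpos : 0 < ‖x‖ := norm_pos_iff.mpr hx0
  rw [heq, norm_div, div_le_iff₀ hpos, ← hxn, ← sq]
  exact Complex.norm_exp_sub_one_sub_id_le (by rwa [hxn])

theorem tendsto_sincPhase_div_pow (N : ℕ) (hN : 1 < N) (ξ : ℝ) (hξ : ξ ≠ 0) :
    Tendsto (fun j : ℕ => sincPhase (ξ / N ^ j)) atTop (𝓝 1) := by
  have hN1 : (1 : ℝ) < N := by exact_mod_cast hN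
  have hlim : Tendsto (fun j : ℕ => 2 * Real.pi * |ξ / N ^ j|) atTop (𝓝 0) := by
    have h1 : Tendsto (fun j : ℕ => ξ / (N : ℝ) ^ j) atTop (𝓝 0) :=
      tendsto_const_nhds.div_atTop (tendsto_pow_atTop_atTop_of_one_lt hN1)
    simpa using (h1.abs.const_mul (2 * Real.pi))
  rw [tendsto_iff_norm_sub_tendsto_zero]
  refine squeeze_zero' (Eventually.of_forall fun _ => norm_nonneg _) ?_ hlim
  filter_upwards [hlim.eventually (ge_mem_nhds (show (0 : ℝ) < 1 by norm_num))] with j hj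
  exact norm_sincPhase_sub_one_le _ (by positivity) hj

/-! ### Decay of the exponential sums -/

/-- Passing from generation `j` to `j + 1` changes the smoothed transform by the error in `hC`
divided by `T ^ (j + 1)` and multiplied by a sinc factor of size `|ξ| ^ (-γ) * N ^ (γ (j + 1))`. The
changes are therefore dominated by `|ξ| ^ (-γ)` times the series `(j + 1) * ρ ^ j` with `ρ = N ^ γ /
√T < 1`. -/
theorem norm_limit_le_rpow {N T : ℕ} (hT : 0 < T) (hTN : T < N) (D : DigitTree N T) (C : ℝ)
    (hC : ∀ (j : ℕ) (θ : ℝ), ‖D.expSum (j + 1) θ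
        - (T / N : ℂ) * (D.expSum j (N * θ) * ∑ d ∈ Finset.range N, phase (d * θ))‖
        ≤ C * (j + 1) * T * √(T ^ j : ℕ))
    (γ : ℝ) (hγ0 : 0 ≤ γ) (hγ1 : γ ≤ 1) (hγT : (N : ℝ) ^ γ < √T) :
    ∃ C' : ℝ, ∀ ξ : ℝ, ξ ≠ 0 → ∀ z : ℂ,
      Tendsto (fun j : ℕ => (1 / T ^ j : ℂ) * D.expSum j (ξ / N ^ j)) atTop (𝓝 z) →
      ‖z‖ ≤ C' * |ξ| ^ (-γ) := by
  have hN0 : 0 < N := hT.trans hTN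
  have hT' : (0 : ℝ) < T := by exact_mod_cast hT
  have hN' : (0 : ℝ) < N := by exact_mod_cast hN0
  have hC0 : 0 ≤ C := by
    have := (norm_nonneg _).trans (hC 0 0)
    simp at this
    nlinarith
  set ρ : ℝ := (N : ℝ) ^ γ / √T with hρ
  have hsT : 0 < √(T : ℝ) := Real.sqrt_pos.mpr hT'
  have hρ0 : 0 ≤ ρ := by positivity
  have hρ1 : ρ < 1 := (div_lt_one hsT).mpr hγT
  have hsum : Summable fun j : ℕ => ((j : ℝ) + 1) * ρ ^ j := by
    have h1 := summable_pow_mul_geometric_of_norm_lt_one 1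
      (r := ρ) (by rwa [Real.norm_of_nonneg hρ0])
    have h2 := summable_geometric_of_lt_one hρ0 hρ1
    refine (h1.add h2).congr fun j => ?_
    simp
    ring
  set S : ℝ := ∑' j : ℕ, ((j : ℝ) + 1) * ρ ^ j with hS
  refine ⟨1 + C * (N : ℝ) ^ γ * S, fun ξ hξ z hz => ?_⟩
  have hξ0 : 0 < |ξ| := abs_pos.mpr hξ
  -- For `ξ ≠ 0` this is the transform of the probability measure spread uniformly over the
  -- intervals of generation `j`. The sinc factor tends to `1`, so it does not affect the limit.
  set h : ℕ → ℂ := fun j => (1 / T ^ j : ℂ) * D.expSum j (ξ / N ^ j) * sincPhase (ξ / N ^ j) with hh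
  have hlim : Tendsto h atTop (𝓝 z) := by
    have := hz.mul (tendsto_sincPhase_div_pow N (by omega) ξ hξ)
    rwa [mul_one] at this
  have hstep : ∀ j, ‖h (j + 1) - h j‖
      ≤ C * (N : ℝ) ^ γ * |ξ| ^ (-γ) * (((j : ℝ) + 1) * ρ ^ j) := by
    intro j
    set θ : ℝ := ξ / N ^ (j + 1) with hθ
    have hNθ : ξ / (N : ℝ) ^ j = N * θ := by
      rw [hθ, pow_succ]; field_simp
    have hθ0 : θ ≠ 0 := by positivity
    have hTC : (T : ℂ) ≠ 0 := Nat.cast_ne_zero.mpr hT.ne'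
    have hNC : (N : ℂ) ≠ 0 := Nat.cast_ne_zero.mpr hN0.ne'
    have heq : h (j + 1) - h j = (1 / T ^ (j + 1) : ℂ) * sincPhase θ
        * (D.expSum (j + 1) θ
          - (T / N : ℂ) * (D.expSum j (N * θ) * ∑ d ∈ Finset.range N, phase (d * θ))) := by
      simp only [hh]
      rw [hNθ, sincPhase_natCast_mul N hN0 θ, ← hθ, pow_succ]
      generalize ∑ d ∈ Finset.range N, phase (d * θ) = G
      field_simp
    have hs : ‖sincPhase θ‖ ≤ |ξ| ^ (-γ) * ((N : ℝ) ^ γ) ^ (j + 1) := by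
      refine (norm_sincPhase_le_rpow θ γ hθ0 hγ0 hγ1).trans (le_of_eq ?_)
      rw [hθ, abs_div, abs_of_pos (show (0 : ℝ) < (N : ℝ) ^ (j + 1) by positivity),
        Real.div_rpow hξ0.le (by positivity), Real.rpow_neg (by positivity : (0:ℝ) ≤ N ^ (j + 1)),
        div_inv_eq_mul, ← Real.rpow_natCast, ← Real.rpow_mul hN'.le, ← Real.rpow_natCast,
        ← Real.rpow_mul hN'.le, mul_comm γ]
    have hsq : √(T ^ j : ℕ) = √(T : ℝ) ^ j := by
      push_cast
      rw [Real.sqrt_eq_iff_mul_self_eq (by positivity) (by positivity), ← mul_pow,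
        Real.mul_self_sqrt hT'.le]
    rw [heq, norm_mul, norm_mul]
    have hn : ‖(1 / T ^ (j + 1) : ℂ)‖ = 1 / (T : ℝ) ^ (j + 1) := by
      simp
    rw [hn]
    calc _ ≤ 1 / (T : ℝ) ^ (j + 1) * (|ξ| ^ (-γ) * ((N : ℝ) ^ γ) ^ (j + 1))
          * (C * (j + 1) * T * √(T ^ j : ℕ)) := by
          gcongr
          exact hC j θ
      _ = _ := by
          rw [hsq, hρ, div_pow]
          have hTT : (T : ℝ) ^ (j + 1) = √(T : ℝ) ^ j * √(T : ℝ) ^ j * T := by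
            rw [← mul_pow, Real.mul_self_sqrt hT'.le, pow_succ]
          rw [hTT]
          field_simp
          ring
  have h0 : ‖h 0‖ ≤ |ξ| ^ (-γ) := by
    have : h 0 = sincPhase ξ := by
      simp [hh, DigitTree.expSum, D.pos_zero, phase_zero]
    rw [this]
    exact norm_sincPhase_le_rpow ξ γ hξ hγ0 hγ1
  have hbound : ∀ J, ‖h J‖ ≤ (1 + C * (N : ℝ) ^ γ * S) * |ξ| ^ (-γ) := by
    intro J
    have htel : h J = h 0 + ∑ j ∈ Finset.range J, (h (j + 1) - h j) := by
      rw [Finset.sum_range_sub]; ring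
    rw [htel]
    refine (norm_add_le _ _).trans ?_
    have h1 : ‖∑ j ∈ Finset.range J, (h (j + 1) - h j)‖
        ≤ C * (N : ℝ) ^ γ * |ξ| ^ (-γ) * S := by
      refine (norm_sum_le _ _).trans ((Finset.sum_le_sum fun j _ => hstep j).trans ?_)
      rw [← Finset.mul_sum]
      gcongr
      exact hsum.sum_le_tsum _ fun j _ => by positivity
    linarith
  exact le_of_tendsto hlim.norm (Eventually.of_forall hbound)

/-! ### Step functions on the unit interval -/

theorem setOf_floor_eq (n u : ℕ) (hu : u < n) :
    {t : ℝ | t ∈ Set.Ico (0 : ℝ) 1 ∧ ⌊n * t⌋₊ = u} = Set.Ico ((u : ℝ) / n) ((u + 1) / n) := by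
  have hn : (0 : ℝ) < n := by exact_mod_cast (Nat.zero_le u).trans_lt hu
  have hun : (u : ℝ) + 1 ≤ n := by exact_mod_cast hu
  ext t
  simp only [Set.mem_ofPred_eq, Set.mem_Ico, div_le_iff₀ hn, lt_div_iff₀ hn]
  constructor
  · rintro ⟨⟨h0, -⟩, h⟩
    rw [Nat.floor_eq_iff (by positivity)] at h
    constructor <;> linarith [h.1, h.2]
  · rintro ⟨h1, h2⟩
    have ht0 : 0 ≤ t := by
      by_contra! ht
      have : t * n < 0 := mul_neg_of_neg_of_pos ht hn
      linarith [Nat.cast_nonneg (α := ℝ) u]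
    refine ⟨⟨ht0, ?_⟩, (Nat.floor_eq_iff (by positivity)).mpr ⟨by linarith, by linarith⟩⟩
    by_contra! ht
    nlinarith

theorem floor_lt_of_mem_Ico (n : ℕ) (hn : 0 < n) (t : ℝ) (ht : t ∈ Set.Ico (0 : ℝ) 1) :
    ⌊n * t⌋₊ < n := by
  have hn' : (0 : ℝ) < n := by exact_mod_cast hn
  rw [Nat.floor_lt (mul_nonneg hn'.le ht.1)]
  nlinarith [ht.2]

theorem volume_setOf_floor_mem_le (n : ℕ) (hn : 0 < n) (W : Finset ℕ) :
    volume {t : ℝ | t ∈ Set.Ico (0 : ℝ) 1 ∧ ⌊n * t⌋₊ ∈ W} ≤ ENNReal.ofReal (W.card / n) := by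
  have hn' : (0 : ℝ) < n := by exact_mod_cast hn
  have hsub : {t : ℝ | t ∈ Set.Ico (0 : ℝ) 1 ∧ ⌊n * t⌋₊ ∈ W}
      ⊆ ⋃ u ∈ W, Set.Ico ((u : ℝ) / n) ((u + 1) / n) := by
    rintro t ⟨ht, hW⟩
    refine Set.mem_biUnion hW ?_
    rw [← setOf_floor_eq n _ (floor_lt_of_mem_Ico n hn t ht)]
    exact ⟨ht, rfl⟩
  refine (measure_mono hsub).trans ((measure_biUnion_finset_le _ _).trans ?_)
  have : ∀ u : ℕ, volume (Set.Ico ((u : ℝ) / n) ((u + 1) / n)) = ENNReal.ofReal (1 / n) := by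
    intro u
    rw [Real.volume_Ico]
    congr 1
    field_simp
    ring
  simp only [this, Finset.sum_const]
  rw [nsmul_eq_mul, ← ENNReal.ofReal_natCast, ← ENNReal.ofReal_mul (by positivity)]
  apply le_of_eq
  congr 1
  ring

theorem integral_comp_floor (n : ℕ) (hn : 0 < n) (h : ℕ → ℂ) :
    ∫ t in Set.Ico (0 : ℝ) 1, h ⌊n * t⌋₊ = (1 / n : ℂ) * ∑ u ∈ Finset.range n, h u := by
  have hn' : (0 : ℝ) < n := by exact_mod_cast hn
  have hU : Set.Ico (0 : ℝ) 1
      = ⋃ u ∈ Finset.range n, {t : ℝ | t ∈ Set.Ico (0 : ℝ) 1 ∧ ⌊n * t⌋₊ = u} := by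
    ext t
    simp only [Set.mem_iUnion, Set.mem_ofPred_eq, Finset.mem_range, exists_prop]
    exact ⟨fun ht => ⟨_, floor_lt_of_mem_Ico n hn t ht, ht, rfl⟩, fun ⟨_, _, ht, _⟩ => ht⟩
  have hmeas : ∀ u ∈ Finset.range n,
      MeasurableSet {t : ℝ | t ∈ Set.Ico (0 : ℝ) 1 ∧ ⌊n * t⌋₊ = u} := by
    intro u hu
    rw [setOf_floor_eq n u (Finset.mem_range.mp hu)]
    exact measurableSet_Ico
  have hval : ∀ u ∈ Finset.range n,
      ∫ t in {t : ℝ | t ∈ Set.Ico (0 : ℝ) 1 ∧ ⌊n * t⌋₊ = u}, h ⌊n * t⌋₊ = (1 / n : ℂ) * h u := by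
    intro u hu
    rw [setIntegral_congr_fun (hmeas u hu) (g := fun _ => h u)
      (fun t ht => by simp only; rw [ht.2]), setIntegral_const,
      setOf_floor_eq n u (Finset.mem_range.mp hu), measureReal_def, Real.volume_Ico]
    have : ((u : ℝ) + 1) / n - u / n = 1 / n := by field_simp; ring
    rw [this, ENNReal.toReal_ofReal (by positivity), Complex.real_smul]
    push_cast
    rfl
  rw [Finset.mul_sum, ← Finset.sum_congr rfl hval]
  conv_lhs => rw [hU]
  refine integral_biUnion_finset _ hmeas ?_ ?_
  · intro u _ v _ huv
    refine Set.disjoint_left.mpr fun t ht ht' => huv ?_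
    exact ht.2.symm.trans ht'.2
  · intro u hu
    refine (integrableOn_congr_fun (g := fun _ => h u) (fun t ht => by simp only; rw [ht.2])
      (hmeas u hu)).mpr (integrableOn_const ?_)
    rw [setOf_floor_eq n u (Finset.mem_range.mp hu), Real.volume_Ico]
    exact ENNReal.ofReal_ne_top

/-! ### The measure carried by a digit tree -/

namespace DigitTree

variable {N T : ℕ} (D : DigitTree N T)

/-- The left endpoint of the interval of generation `j` that contains the point with
parameter `t`. -/
noncomputable def level (j : ℕ) (t : ℝ) : ℝ := D.pos j ⌊(T ^ j : ℕ) * t⌋₊ / N ^ j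

/-- The point with parameter `t`. -/
noncomputable def point (t : ℝ) : ℝ := ⨆ j, D.level j t

/-- The natural probability measure. -/
noncomputable def measure : Measure ℝ := (volume.restrict (Set.Ico 0 1)).map D.point

/-- The natural Cantor set. -/
def limitSet : Set ℝ :=
  ⋂ j : ℕ, ⋃ u ∈ Finset.range (T ^ j), Set.Icc ((D.pos j u : ℝ) / N ^ j) ((D.pos j u + 1) / N ^ j)

/-- Dropping the last base-`T` digit of `⌊T ^ (j+1) * t⌋` leaves `⌊T ^ j * t⌋`. The base-`T`
expansion of `t` thus traces a path down the tree, which makes the intervals along it nested. -/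
theorem pos_succ_div_floor (hT : 0 < T) (j : ℕ) (t : ℝ) :
    D.pos (j + 1) ⌊(T ^ (j + 1) : ℕ) * t⌋₊ / N = D.pos j ⌊(T ^ j : ℕ) * t⌋₊ := by
  have hT' : (0 : ℝ) < T := by exact_mod_cast hT
  rw [D.pos_succ_div, ← Nat.floor_div_natCast]
  congr 3
  push_cast
  rw [pow_succ]
  field_simp

theorem level_le_succ (hT : 0 < T) (hN : 0 < N) (j : ℕ) (t : ℝ) :
    D.level j t ≤ D.level (j + 1) t := by
  have hN' : (0 : ℝ) < N := by exact_mod_cast hN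
  have h := Nat.div_mul_le_self (D.pos (j + 1) ⌊(T ^ (j + 1) : ℕ) * t⌋₊) N
  rw [D.pos_succ_div_floor hT] at h
  have h' : (D.pos j ⌊(T ^ j : ℕ) * t⌋₊ : ℝ) * N ≤ D.pos (j + 1) ⌊(T ^ (j + 1) : ℕ) * t⌋₊ := by
    exact_mod_cast h
  unfold level
  rw [div_le_div_iff₀ (by positivity) (by positivity), pow_succ (N : ℝ) j]
  nlinarith [pow_pos hN' j]

theorem level_succ_add_le (hT : 0 < T) (hN : 0 < N) (j : ℕ) (t : ℝ) :
    D.level (j + 1) t + 1 / N ^ (j + 1) ≤ D.level j t + 1 / N ^ j := by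
  have hN' : (0 : ℝ) < N := by exact_mod_cast hN
  have h := Nat.lt_mul_div_succ (D.pos (j + 1) ⌊(T ^ (j + 1) : ℕ) * t⌋₊) hN
  rw [D.pos_succ_div_floor hT] at h
  have h' : (D.pos (j + 1) ⌊(T ^ (j + 1) : ℕ) * t⌋₊ : ℝ) + 1
      ≤ N * (D.pos j ⌊(T ^ j : ℕ) * t⌋₊ + 1) := by
    exact_mod_cast h
  unfold level
  rw [← add_div, ← add_div, div_le_div_iff₀ (by positivity) (by positivity),
    pow_succ (N : ℝ) j]
  nlinarith [pow_pos hN' j]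

theorem level_monotone (hT : 0 < T) (hN : 0 < N) (t : ℝ) : Monotone fun j => D.level j t :=
  monotone_nat_of_le_succ fun j => D.level_le_succ hT hN j t

theorem level_add_antitone (hT : 0 < T) (hN : 0 < N) (t : ℝ) :
    Antitone fun j => D.level j t + 1 / (N : ℝ) ^ j :=
  antitone_nat_of_succ_le fun j => D.level_succ_add_le hT hN j t

theorem level_le_level_add (hT : 0 < T) (hN : 0 < N) (i j : ℕ) (t : ℝ) :
    D.level i t ≤ D.level j t + 1 / (N : ℝ) ^ j := by
  have h1 := D.level_monotone hT hN t (le_max_left i j)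
  have h2 := D.level_add_antitone hT hN t (le_max_right i j)
  have h3 : (0 : ℝ) ≤ 1 / (N : ℝ) ^ (max i j) := by positivity
  simp only at h1 h2
  linarith

theorem bddAbove_level (hT : 0 < T) (hN : 0 < N) (t : ℝ) :
    BddAbove (Set.range fun j => D.level j t) := by
  refine ⟨D.level 0 t + 1 / (N : ℝ) ^ 0, ?_⟩
  rintro _ ⟨j, rfl⟩
  exact D.level_le_level_add hT hN j 0 t

theorem level_le_point (hT : 0 < T) (hN : 0 < N) (j : ℕ) (t : ℝ) : D.level j t ≤ D.point t :=
  le_ciSup (D.bddAbove_level hT hN t) j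

theorem point_le_level_add (hT : 0 < T) (hN : 0 < N) (j : ℕ) (t : ℝ) :
    D.point t ≤ D.level j t + 1 / (N : ℝ) ^ j :=
  ciSup_le fun i => D.level_le_level_add hT hN i j t

theorem measurable_level (j : ℕ) : Measurable (D.level j) := by
  have h : Measurable fun n : ℕ => (D.pos j n : ℝ) / N ^ j := measurable_from_top
  exact h.comp (Nat.measurable_floor.comp (measurable_const.mul measurable_id))

theorem measurable_point : Measurable D.point :=
  Measurable.iSup D.measurable_level

theorem isProbabilityMeasure_measure : IsProbabilityMeasure D.measure := by
  refine ⟨?_⟩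
  rw [measure, Measure.map_apply D.measurable_point MeasurableSet.univ]
  simp

theorem isCompact_limitSet : IsCompact D.limitSet := by
  have hclosed : ∀ j : ℕ, IsClosed (⋃ u ∈ Finset.range (T ^ j),
      Set.Icc ((D.pos j u : ℝ) / N ^ j) ((D.pos j u + 1) / N ^ j)) := fun j =>
    isClosed_biUnion_finset fun u _ => isClosed_Icc
  refine IsCompact.of_isClosed_subset (isCompact_Icc (a := (0 : ℝ)) (b := 1))
    (isClosed_iInter hclosed) fun x hx => ?_
  have := Set.mem_iInter.mp hx 0
  simpa [D.pos_zero] using this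

theorem limitSet_subset : D.limitSet ⊆ Set.Icc 0 1 := fun x hx => by
  have := Set.mem_iInter.mp hx 0
  simpa [D.pos_zero] using this

theorem point_mem_limitSet (hT : 0 < T) (hN : 0 < N) (t : ℝ) (ht : t ∈ Set.Ico (0 : ℝ) 1) :
    D.point t ∈ D.limitSet := by
  refine Set.mem_iInter.mpr fun j => ?_
  refine Set.mem_biUnion (x := ⌊(T ^ j : ℕ) * t⌋₊)
    (Finset.mem_coe.mpr (Finset.mem_range.mpr (floor_lt_of_mem_Ico _ (by positivity) t ht))) ?_
  rw [add_div]
  exact ⟨D.level_le_point hT hN j t, D.point_le_level_add hT hN j t⟩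

theorem measure_compl_limitSet (hT : 0 < T) (hN : 0 < N) : D.measure D.limitSetᶜ = 0 := by
  rw [measure, Measure.map_apply D.measurable_point D.isCompact_limitSet.measurableSet.compl,
    Measure.restrict_apply
      (D.measurable_point D.isCompact_limitSet.measurableSet.compl)]
  convert measure_empty (μ := (volume : Measure ℝ))
  refine Set.eq_empty_of_forall_notMem fun t ht => ?_
  exact ht.1 (D.point_mem_limitSet hT hN t ht.2)

/-- The `T ^ j` intervals of generation `j` cover, and the sum of their lengths to the power `α` is
`T ^ j * N ^ (-jα) = 1`. -/
theorem dimH_limitSet_le (hT : 0 < T) (hN : 1 < N) (α : ℝ≥0) (hα : (N : ℝ) ^ (α : ℝ) = T) :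
    dimH D.limitSet ≤ α := by
  have hN' : (1 : ℝ) < N := by exact_mod_cast hN
  have hN0 : (0 : ℝ) < N := by linarith
  have hT' : (0 : ℝ) < T := by exact_mod_cast hT
  refine dimH_le_of_hausdorffMeasure_ne_top (ne_top_of_le_ne_top ENNReal.one_ne_top ?_)
  have hdiam : ∀ (j : ℕ) (u : ℕ), Metric.ediam
      (Set.Icc ((D.pos j u : ℝ) / N ^ j) ((D.pos j u + 1) / N ^ j))
      = ENNReal.ofReal (1 / (N : ℝ) ^ j) := by
    intro j u
    rw [Real.ediam_Icc]
    congr 1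
    rw [add_div]
    ring
  refine (Measure.hausdorffMeasure_le_liminf_sum (ι := fun j : ℕ => Fin (T ^ j)) (α : ℝ)
    D.limitSet (l := atTop) (fun j => ENNReal.ofReal (1 / (N : ℝ) ^ j)) ?_
    (fun j u => Set.Icc ((D.pos j u : ℝ) / N ^ j) ((D.pos j u + 1) / N ^ j))
    (Eventually.of_forall fun j u => (hdiam j u).le) (Eventually.of_forall fun j => ?_)).trans ?_
  · rw [← ENNReal.ofReal_zero]
    refine ENNReal.tendsto_ofReal ?_
    exact tendsto_const_nhds.div_atTop (tendsto_pow_atTop_atTop_of_one_lt hN')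
  · intro x hx
    have := Set.mem_iInter.mp hx j
    simp only [Set.mem_iUnion, Finset.mem_range] at this ⊢
    obtain ⟨u, hu, h⟩ := this
    exact ⟨⟨u, hu⟩, h⟩
  · have : ∀ j : ℕ, ∑ u : Fin (T ^ j), Metric.ediam
        (Set.Icc ((D.pos j u : ℝ) / N ^ j) ((D.pos j u + 1) / N ^ j)) ^ (α : ℝ) = 1 := by
      intro j
      have h1 : (1 / (N : ℝ) ^ j) ^ (α : ℝ) = 1 / (T : ℝ) ^ j := by
        rw [Real.div_rpow (by norm_num) (by positivity), Real.one_rpow, ← hα,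
          ← Real.rpow_natCast, ← Real.rpow_natCast, ← Real.rpow_mul hN0.le,
          ← Real.rpow_mul hN0.le, mul_comm]
      simp only [hdiam]
      rw [Finset.sum_const, Finset.card_univ, Fintype.card_fin, nsmul_eq_mul,
        ENNReal.ofReal_rpow_of_nonneg (by positivity) α.coe_nonneg, h1, ← ENNReal.ofReal_natCast,
        ← ENNReal.ofReal_mul (by positivity)]
      push_cast
      rw [mul_one_div_cancel (by positivity), ENNReal.ofReal_one]
    simp only [this]
    simp

theorem card_filter_pos_mem_Icc_le (j : ℕ) (a : ℝ) :
    ((Finset.range (T ^ j)).filter fun u => (D.pos j u : ℝ) ∈ Set.Icc a (a + 3)).card ≤ 4 := by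
  have hinj : Set.InjOn (fun u => (D.pos j u : ℤ))
      ((Finset.range (T ^ j)).filter fun u => (D.pos j u : ℝ) ∈ Set.Icc a (a + 3)) := by
    intro u hu v hv huv
    simp only [Finset.coe_filter, Finset.mem_range, Set.mem_ofPred_eq] at hu hv
    exact D.pos_injOn j hu.1 hv.1 (Nat.cast_injective huv)
  have hmaps : ∀ u ∈ (Finset.range (T ^ j)).filter fun u => (D.pos j u : ℝ) ∈ Set.Icc a (a + 3),
      (D.pos j u : ℤ) ∈ Finset.Icc ⌈a⌉ (⌈a⌉ + 3) := by
    intro u hu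
    simp only [Finset.mem_filter, Set.mem_Icc] at hu
    rw [Finset.mem_Icc]
    constructor
    · exact Int.ceil_le.mpr (by exact_mod_cast hu.2.1)
    · have h1 := Int.le_ceil a
      have : ((D.pos j u : ℤ) : ℝ) ≤ (⌈a⌉ + 3 : ℤ) := by
        push_cast
        linarith [hu.2.2]
      exact_mod_cast this
  refine (Finset.card_le_card_of_injOn _ hmaps hinj).trans ?_
  rw [Int.card_Icc]
  omega

theorem measure_closedBall_le_of_le (hT : 0 < T) (hN : 0 < N) (j : ℕ) (x r : ℝ)
    (hr : r ≤ 1 / (N : ℝ) ^ j) :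
    D.measure (Metric.closedBall x r) ≤ ENNReal.ofReal (4 / (T : ℝ) ^ j) := by
  have hN' : (0 : ℝ) < N := by exact_mod_cast hN
  have hP : (0 : ℝ) < (N : ℝ) ^ j := by positivity
  rw [le_div_iff₀ hP] at hr
  -- An interval of generation `j` meeting the ball has its left endpoint in `[x - r - N ^ (-j), x +
  -- r]`. Rescaled by `N ^ j`, this has length at most `3`, so it contains at most four integers.
  set a : ℝ := (x - r) * N ^ j - 1 with ha
  rw [measure, Measure.map_apply D.measurable_point measurableSet_closedBall,
    Measure.restrict_apply (D.measurable_point measurableSet_closedBall)]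
  refine (measure_mono (t := {t : ℝ | t ∈ Set.Ico (0 : ℝ) 1 ∧ ⌊(T ^ j : ℕ) * t⌋₊ ∈
    (Finset.range (T ^ j)).filter fun u => (D.pos j u : ℝ) ∈ Set.Icc a (a + 3)}) ?_).trans
    ((volume_setOf_floor_mem_le _ (by positivity) _).trans ?_)
  · rintro t ⟨ht, ht'⟩
    refine ⟨ht', Finset.mem_filter.mpr ⟨Finset.mem_range.mpr
      (floor_lt_of_mem_Ico _ (by positivity) t ht'), ?_⟩⟩
    have h1 := D.level_le_point hT hN j t
    have h2 := D.point_le_level_add hT hN j t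
    rw [Set.mem_preimage, Real.closedBall_eq_Icc] at ht
    have h3 : D.level j t * N ^ j = D.pos j ⌊(T ^ j : ℕ) * t⌋₊ := by
      unfold level
      field_simp
    rw [← h3]
    have h4 : x - r ≤ D.level j t + 1 / N ^ j := ht.1.trans h2
    have h5 : D.level j t ≤ x + r := h1.trans ht.2
    have h6 := mul_le_mul_of_nonneg_right h4 hP.le
    have h7 := mul_le_mul_of_nonneg_right h5 hP.le
    rw [add_mul, one_div_mul_cancel hP.ne'] at h6
    constructor
    · linarith
    · rw [ha]
      nlinarith
  · refine ENNReal.ofReal_le_ofReal ?_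
    push_cast
    gcongr
    exact_mod_cast D.card_filter_pos_mem_Icc_le j a

theorem measure_closedBall_le (hT : 0 < T) (hN : 1 < N) (α : ℝ) (hα0 : 0 ≤ α)
    (hα : (N : ℝ) ^ α = T) (x r : ℝ) (hr : 0 < r) :
    D.measure (Metric.closedBall x r) ≤ ENNReal.ofReal (4 * T * r ^ α) := by
  have hN' : (1 : ℝ) < N := by exact_mod_cast hN
  have hN0 : (0 : ℝ) < N := by linarith
  have hT' : (1 : ℝ) ≤ T := by exact_mod_cast hT
  have := D.isProbabilityMeasure_measure
  rcases le_total 1 r with h1 | h1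
  · refine prob_le_one.trans ?_
    rw [ENNReal.one_le_ofReal]
    have := Real.one_le_rpow h1 hα0
    nlinarith
  -- Here `N ^ (-(j+1)) < r ≤ N ^ (-j)`. Overshooting by at most one generation costs the factor `T`
  -- in the constant.
  · obtain ⟨j, hj1, hj2⟩ := exists_nat_pow_near_of_lt_one hr h1 (inv_pos.mpr hN0)
      (inv_lt_one_of_one_lt₀ hN')
    refine (D.measure_closedBall_le_of_le hT (by omega) j x r
      (by rwa [one_div, ← inv_pow])).trans (ENNReal.ofReal_le_ofReal ?_)
    have h2 : 1 / (T : ℝ) ^ (j + 1) ≤ r ^ α := by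
      calc 1 / (T : ℝ) ^ (j + 1) = ((N : ℝ)⁻¹ ^ (j + 1)) ^ α := by
            rw [← hα, inv_pow, Real.inv_rpow (by positivity), ← Real.rpow_natCast,
              ← Real.rpow_natCast, ← Real.rpow_mul hN0.le, ← Real.rpow_mul hN0.le, mul_comm,
              one_div]
        _ ≤ r ^ α := Real.rpow_le_rpow (by positivity) hj1.le hα0
    calc 4 / (T : ℝ) ^ j = 4 * T * (1 / (T : ℝ) ^ (j + 1)) := by
          rw [pow_succ]; field_simp
      _ ≤ _ := by gcongr

/-! ### Fourier decay of the natural measure -/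

theorem integral_phase_level (hT : 0 < T) (j : ℕ) (ξ : ℝ) :
    ∫ t in Set.Ico (0 : ℝ) 1, phase (D.level j t * ξ)
      = (1 / T ^ j : ℂ) * D.expSum j (ξ / N ^ j) := by
  have := integral_comp_floor (T ^ j) (by positivity)
    (fun u => phase ((D.pos j u : ℝ) / N ^ j * ξ))
  simp only [level]
  rw [this]
  push_cast
  unfold expSum
  congr 1
  refine Finset.sum_congr rfl fun u _ => ?_
  congr 1
  ring

theorem integral_phase_measure (ξ : ℝ) :
    ∫ x, phase (x * ξ) ∂D.measure = ∫ t in Set.Ico (0 : ℝ) 1, phase (D.point t * ξ) := by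
  rw [measure, integral_map D.measurable_point.aemeasurable]
  exact (continuous_phase.comp (continuous_id.mul continuous_const)).aestronglyMeasurable

theorem integrableOn_phase_comp (f : ℝ → ℝ) (hf : Measurable f) :
    IntegrableOn (fun t => phase (f t)) (Set.Ico (0 : ℝ) 1) := by
  refine Measure.integrableOn_of_bounded (M := 1) (by simp)
    (continuous_phase.measurable.comp hf).aestronglyMeasurable
    (Eventually.of_forall fun t => (norm_phase _).le)

/-- The normalised sum is the integral of the character along `level j`, which stays within `N ^
(-j)` of `point`. The Lipschitz bound for `phase` then gives an error `2π|ξ| / N ^ j`. -/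
theorem tendsto_expSum (hT : 0 < T) (hN : 1 < N) (ξ : ℝ) :
    Tendsto (fun j : ℕ => (1 / T ^ j : ℂ) * D.expSum j (ξ / N ^ j)) atTop
      (𝓝 (∫ x, phase (x * ξ) ∂D.measure)) := by
  have hN' : (1 : ℝ) < N := by exact_mod_cast hN
  have hlim : Tendsto (fun j : ℕ => 2 * Real.pi * |ξ| * (1 / (N : ℝ) ^ j)) atTop (𝓝 0) := by
    have h1 : Tendsto (fun j : ℕ => 1 / (N : ℝ) ^ j) atTop (𝓝 0) :=
      tendsto_const_nhds.div_atTop (tendsto_pow_atTop_atTop_of_one_lt hN')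
    simpa using h1.const_mul (2 * Real.pi * |ξ|)
  rw [tendsto_iff_norm_sub_tendsto_zero]
  refine squeeze_zero (fun _ => norm_nonneg _) (fun j => ?_) hlim
  rw [← D.integral_phase_level hT, D.integral_phase_measure, ← integral_sub
    (integrableOn_phase_comp _ ((D.measurable_level j).mul_const ξ))
    (integrableOn_phase_comp _ (D.measurable_point.mul_const ξ))]
  refine (norm_setIntegral_le_of_norm_le_const (C := 2 * Real.pi * |ξ| * (1 / (N : ℝ) ^ j))
    (by simp) fun t _ => ?_).trans (by simp [measureReal_def])
  refine (norm_phase_sub_le _ _).trans ?_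
  rw [← sub_mul, abs_mul, mul_assoc (2 * Real.pi), mul_comm |ξ|]
  have h1 := D.level_le_point hT (by omega) j t
  have h2 := D.point_le_level_add hT (by omega) j t
  have h3 : |D.level j t - D.point t| ≤ 1 / (N : ℝ) ^ j := by
    rw [abs_le]; constructor <;> linarith
  have := Real.pi_pos
  gcongr

end DigitTree

theorem measureFourier_one_eq (μ : Measure ℝ) (ξ : ℝ) :
    measureFourier μ (fun _ => 1) ξ = ∫ x, phase (x * ξ) ∂μ := by
  rw [measureFourier_apply]
  refine integral_congr_ae (Eventually.of_forall fun x => ?_)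
  simp only [phase, mul_one]
  congr 1
  push_cast
  ring

theorem norm_integral_phase_le_one (μ : Measure ℝ) [IsProbabilityMeasure μ] (ξ : ℝ) :
    ‖∫ x, phase (x * ξ) ∂μ‖ ≤ 1 := by
  refine (norm_integral_le_of_norm_le_const (C := 1)
    (Eventually.of_forall fun x => (norm_phase _).le)).trans ?_
  simp

theorem fourierDecay_of_nonpos (μ : Measure ℝ) [IsProbabilityMeasure μ] (β : ℝ) (hβ : β ≤ 0) :
    FourierDecay μ β := by
  refine ⟨1, fun ξ => ?_⟩
  rw [measureFourier_one_eq, one_mul]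
  refine (norm_integral_phase_le_one μ ξ).trans (Real.one_le_rpow ?_ (by linarith))
  linarith [abs_nonneg ξ]

theorem fourierDecay_of_norm_le_rpow (μ : Measure ℝ) [IsProbabilityMeasure μ] (β C : ℝ)
    (hβ : 0 ≤ β) (h : ∀ ξ : ℝ, ξ ≠ 0 → ‖∫ x, phase (x * ξ) ∂μ‖ ≤ C * |ξ| ^ (-β / 2)) :
    FourierDecay μ β := by
  have hC : 0 ≤ C := by
    have := (norm_nonneg _).trans (h 1 one_ne_zero)
    simpa using this
  refine ⟨(1 + C) * 2 ^ (β / 2), fun ξ => ?_⟩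
  rw [measureFourier_one_eq]
  have h2 : (2 : ℝ) ^ (β / 2) * 2 ^ (-β / 2) = 1 := by
    rw [← Real.rpow_add (by norm_num)]
    ring_nf
    exact Real.rpow_zero _
  have hx := abs_nonneg ξ
  have h2pos : (0 : ℝ) < 2 ^ (β / 2) := by positivity
  rcases le_total |ξ| 1 with h1 | h1
  · have h3 : (2 : ℝ) ^ (-β / 2) ≤ (1 + |ξ|) ^ (-β / 2) :=
      Real.rpow_le_rpow_of_nonpos (by positivity) (by linarith) (by linarith)
    calc ‖∫ x, phase (x * ξ) ∂μ‖ ≤ 1 := norm_integral_phase_le_one μ ξ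
      _ ≤ (1 + C) * 1 := by linarith
      _ = (1 + C) * 2 ^ (β / 2) * 2 ^ (-β / 2) := by rw [mul_assoc, h2]
      _ ≤ _ := by gcongr
  · have h3 : (2 * |ξ|) ^ (-β / 2) ≤ (1 + |ξ|) ^ (-β / 2) :=
      Real.rpow_le_rpow_of_nonpos (by positivity) (by linarith) (by linarith)
    have hpos : 0 < |ξ| := by linarith
    calc ‖∫ x, phase (x * ξ) ∂μ‖ ≤ C * |ξ| ^ (-β / 2) := h ξ (abs_pos.mp hpos)
      _ ≤ (1 + C) * |ξ| ^ (-β / 2) := by gcongr; linarith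
      _ = (1 + C) * 2 ^ (β / 2) * (2 * |ξ|) ^ (-β / 2) := by
          rw [Real.mul_rpow (by norm_num) hx, mul_assoc, ← mul_assoc (2 ^ (β / 2)), h2, one_mul]
      _ ≤ _ := by gcongr

/-- A Salem measure of dimension `α = log T / log N` satisfying the exact ball condition. -/
theorem exists_salem_measure (N T : ℕ) (hT : 0 < T) (hTN : T < N) (α : ℝ≥0) (hα1 : α < 1)
    (hα : (N : ℝ) ^ (α : ℝ) = T) :
    ∃ (ν : Measure ℝ) (K : Set ℝ), IsProbabilityMeasure ν ∧ IsCompact K ∧ K ⊆ Set.Icc 0 1 ∧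
      ν Kᶜ = 0 ∧ dimH K ≤ α ∧
      (∀ x r : ℝ, 0 < r → ν (Metric.closedBall x r) ≤ ENNReal.ofReal (4 * T * r ^ (α : ℝ))) ∧
      ∀ β : ℝ, 0 ≤ β → β < α → FourierDecay ν β := by
  have hN : 1 < N := by omega
  have hN' : (1 : ℝ) < N := by exact_mod_cast hN
  obtain ⟨D, C, hC⟩ := exists_digitTree N T hT hTN
  have := D.isProbabilityMeasure_measure
  refine ⟨D.measure, D.limitSet, D.isProbabilityMeasure_measure, D.isCompact_limitSet,
    D.limitSet_subset, D.measure_compl_limitSet hT (by omega), D.dimH_limitSet_le hT hN α hα,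
    D.measure_closedBall_le hT hN α α.coe_nonneg hα, fun β hβ0 hβ => ?_⟩
  have hα1' : (α : ℝ) < 1 := by exact_mod_cast hα1
  -- The required inequality `N ^ (β/2) < √T` is `β < α`, since `√T = N ^ (α/2)`.
  obtain ⟨C', hC'⟩ := norm_limit_le_rpow hT hTN D C hC (β / 2) (by linarith) (by linarith) (by
    rw [← hα, Real.sqrt_eq_rpow, ← Real.rpow_mul (by linarith)]
    exact Real.rpow_lt_rpow_of_exponent_lt hN' (by linarith))
  refine fourierDecay_of_norm_le_rpow _ β C' hβ0 fun ξ hξ => ?_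
  rw [neg_div]
  exact hC' ξ hξ _ (D.tendsto_expSum hT hN ξ)

/-! ### Superposing rescaled copies of a measure along arithmetic progressions -/

/-- The similarity of ratio `N ^ (-2k)` onto the `a`-th interval of the `k`-th progression. -/
noncomputable def copyMap (N T k a : ℕ) (y : ℝ) : ℝ := a / (2 * T : ℝ) ^ k + y / (N : ℝ) ^ (2 * k)

/-- The `k`-th layer: `T ^ k` small copies of `ν` in arithmetic progression. -/
noncomputable def layer (N T : ℕ) (ν : Measure ℝ) (k : ℕ) : Measure ℝ :=
  ENNReal.ofReal (1 / (T : ℝ) ^ (2 * k)) • ∑ a ∈ Finset.range (T ^ k), ν.map (copyMap N T k a)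

/-- The weighted sum of all the layers. -/
noncomputable def superposition (N T : ℕ) (ν : Measure ℝ) (w : ℕ → ℝ) : Measure ℝ :=
  Measure.sum fun k => ENNReal.ofReal (w k) • layer N T ν k

/-- The copies of `K` that make up the `k`-th layer. -/
def layerSet (N T : ℕ) (K : Set ℝ) (k : ℕ) : Set ℝ :=
  ⋃ a ∈ Finset.range (T ^ k), copyMap N T k a '' K

theorem continuous_copyMap (N T k a : ℕ) : Continuous (copyMap N T k a) := by
  unfold copyMap
  fun_prop

theorem measurable_copyMap (N T k a : ℕ) : Measurable (copyMap N T k a) :=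
  (continuous_copyMap N T k a).measurable

section Layer

variable {N T : ℕ} (hT : 2 ≤ T) (hTN : T < N)

include hT hTN in
-- The spacing `(2T) ^ (-k)` of a progression is at least the length `N ^ (-2k)` of a copy, so a
-- ball no larger than a copy meets boundedly many of them.
theorem two_mul_pow_le_pow (k : ℕ) : (2 * T : ℝ) ^ k ≤ (N : ℝ) ^ (2 * k) := by
  rw [pow_mul]
  have : 2 * T ≤ N ^ 2 := by nlinarith
  have h : (2 * T : ℝ) ≤ (N : ℝ) ^ 2 := by exact_mod_cast this
  gcongr

theorem layer_apply (ν : Measure ℝ) (k : ℕ) {s : Set ℝ} (hs : MeasurableSet s) :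
    layer N T ν k s = ENNReal.ofReal (1 / (T : ℝ) ^ (2 * k))
      * ∑ a ∈ Finset.range (T ^ k), ν (copyMap N T k a ⁻¹' s) := by
  unfold layer
  rw [Measure.smul_apply, smul_eq_mul, Measure.finsetSum_apply]
  congr 1
  refine Finset.sum_congr rfl fun a _ => ?_
  rw [Measure.map_apply (measurable_copyMap N T k a) hs]

include hT in
theorem layer_eq_of_preimage (ν : Measure ℝ) [IsProbabilityMeasure ν] (k : ℕ) {s : Set ℝ}
    (hs : MeasurableSet s) (h : ∀ a ∈ Finset.range (T ^ k), ν (copyMap N T k a ⁻¹' s) = 1) :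
    layer N T ν k s = ENNReal.ofReal (1 / (T : ℝ) ^ k) := by
  have hT' : (0 : ℝ) < T := by positivity
  rw [layer_apply ν k hs, Finset.sum_congr rfl h]
  simp only [Finset.sum_const, Finset.card_range, nsmul_eq_mul, mul_one]
  rw [← ENNReal.ofReal_natCast, ← ENNReal.ofReal_mul (by positivity)]
  congr 1
  push_cast
  rw [two_mul, pow_add]
  field_simp

include hT in
theorem layer_univ (ν : Measure ℝ) [IsProbabilityMeasure ν] (k : ℕ) :
    layer N T ν k Set.univ = ENNReal.ofReal (1 / (T : ℝ) ^ k) :=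
  layer_eq_of_preimage hT ν k MeasurableSet.univ fun a _ => by simp

theorem superposition_apply (ν : Measure ℝ) (w : ℕ → ℝ) {s : Set ℝ} (hs : MeasurableSet s) :
    superposition N T ν w s = ∑' k, ENNReal.ofReal (w k) * layer N T ν k s := by
  unfold superposition
  rw [Measure.sum_apply _ hs]
  rfl

include hT in
theorem isProbabilityMeasure_superposition (ν : Measure ℝ) [IsProbabilityMeasure ν] (w : ℕ → ℝ)
    (hw : ∀ k, 0 < w k) (hw1 : HasSum (fun k => w k / (T : ℝ) ^ k) 1) :
    IsProbabilityMeasure (superposition N T ν w) := by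
  refine ⟨?_⟩
  rw [superposition_apply ν w MeasurableSet.univ]
  have h : ∀ k, ENNReal.ofReal (w k) * layer N T ν k Set.univ
      = ENNReal.ofReal (w k / (T : ℝ) ^ k) := fun k => by
    rw [layer_univ hT, ← ENNReal.ofReal_mul (hw k).le, mul_one_div]
  simp only [h]
  have hT' : (0 : ℝ) < T := by positivity
  rw [← ENNReal.ofReal_tsum_of_nonneg (fun k => (div_pos (hw k) (by positivity)).le) hw1.summable,
    hw1.tsum_eq, ENNReal.ofReal_one]

/-! ### The ball condition -/

theorem card_filter_abs_sub_le (n : ℕ) (g x ρ : ℝ) (hg : 0 < g) (hρ : 0 ≤ ρ) :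
    (((Finset.range n).filter fun a : ℕ => |a / g - x| ≤ ρ).card : ℝ) ≤ 2 * ρ * g + 1 := by
  have hmaps : ∀ a ∈ (Finset.range n).filter fun a : ℕ => |a / g - x| ≤ ρ,
      (a : ℤ) ∈ Finset.Icc ⌈(x - ρ) * g⌉ ⌊(x + ρ) * g⌋ := by
    intro a ha
    obtain ⟨h1, h2⟩ := abs_le.mp (Finset.mem_filter.mp ha).2
    rw [Finset.mem_Icc, Int.ceil_le, Int.le_floor, Int.cast_natCast, ← le_div_iff₀ hg,
      ← div_le_iff₀ hg]
    constructor <;> linarith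
  have hcard := Finset.card_le_card_of_injOn _ hmaps (Nat.cast_injective.injOn)
  rw [Int.card_Icc] at hcard
  have hc : (((Finset.range n).filter fun a : ℕ => |a / g - x| ≤ ρ).card : ℤ)
      ≤ max (⌊(x + ρ) * g⌋ + 1 - ⌈(x - ρ) * g⌉) 0 := by
    rw [← Int.toNat_eq_max]
    exact_mod_cast hcard
  have hc' : (((Finset.range n).filter fun a : ℕ => |a / g - x| ≤ ρ).card : ℝ)
      ≤ max ((⌊(x + ρ) * g⌋ : ℝ) + 1 - ⌈(x - ρ) * g⌉) 0 := by
    exact_mod_cast hc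
  refine hc'.trans (max_le ?_ (by positivity))
  have h1 := Int.floor_le ((x + ρ) * g)
  have h2 := Int.le_ceil ((x - ρ) * g)
  linarith

include hT hTN in
-- If `r ≤ N ^ (-2k)`, the ball meets at most five copies and the ball condition of `ν` rescales
-- exactly, because `N ^ (2kα) = T ^ (2k)`. If `r` is larger, it meets at most `4r(2T) ^ k + 1`
-- copies of mass at most `T ^ (-2k)`. Since `2T ≤ T²`, their total is at most `4r + T ^ (-2k) ≤ 5 *
-- r ^ α`.
theorem layer_closedBall_le (ν : Measure ℝ) [IsProbabilityMeasure ν] (hν : ν (Set.Icc 0 1)ᶜ = 0)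
    (α C : ℝ) (hα0 : 0 ≤ α) (hα1 : α ≤ 1) (hα : (N : ℝ) ^ α = T) (hC1 : 1 ≤ C)
    (hC : ∀ x r : ℝ, 0 < r → ν (Metric.closedBall x r) ≤ ENNReal.ofReal (C * r ^ α))
    (k : ℕ) (x r : ℝ) (hr : 0 < r) (hr1 : r ≤ 1) :
    layer N T ν k (Metric.closedBall x r) ≤ ENNReal.ofReal (5 * C * r ^ α) := by
  have hN0 : (0 : ℝ) < N := by
    have : 0 < N := by omega
    exact_mod_cast this
  have hT2 : (2 : ℝ) ≤ T := by exact_mod_cast hT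
  have hT0 : (0 : ℝ) < T := by linarith
  set P : ℝ := (N : ℝ) ^ (2 * k) with hP
  set g : ℝ := (2 * T : ℝ) ^ k with hg
  have hP0 : 0 < P := by positivity
  have hg0 : 0 < g := by positivity
  have hgP : g ≤ P := two_mul_pow_le_pow hT hTN k
  have hPα : P ^ α = (T : ℝ) ^ (2 * k) := by
    rw [hP, ← hα, ← Real.rpow_natCast, ← Real.rpow_natCast, ← Real.rpow_mul hN0.le,
      ← Real.rpow_mul hN0.le, mul_comm]
  have hpre : ∀ a : ℕ, copyMap N T k a ⁻¹' Metric.closedBall x r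
      = Metric.closedBall ((x - a / g) * P) (r * P) := by
    intro a
    ext y
    simp only [Set.mem_preimage, Metric.mem_closedBall, Real.dist_eq, copyMap]
    rw [show y - (x - a / g) * P = (a / g + y / P - x) * P by field_simp; ring, abs_mul,
      abs_of_pos hP0, mul_le_mul_iff_left₀ hP0]
  set m : ℝ := min 1 (C * (r * P) ^ α) with hm
  have hm0 : 0 ≤ m := le_min zero_le_one (by positivity)
  have hle : ∀ a : ℕ, ν (copyMap N T k a ⁻¹' Metric.closedBall x r) ≤ ENNReal.ofReal m := by
    intro a
    rw [hpre, hm, ENNReal.ofReal_min, ENNReal.ofReal_one]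
    exact le_min prob_le_one (hC _ _ (by positivity))
  have hzero : ∀ a : ℕ, ¬ |a / g - x| ≤ r + 1 / P →
      ν (copyMap N T k a ⁻¹' Metric.closedBall x r) = 0 := by
    intro a ha
    refine measure_mono_null (t := (Set.Icc 0 1)ᶜ) (fun y hy hy01 => ha ?_) hν
    simp only [Set.mem_preimage, Metric.mem_closedBall, Real.dist_eq, copyMap] at hy
    have h1 := abs_le.mp hy
    have h2 : 0 ≤ y / P := div_nonneg hy01.1 hP0.le
    have h3 : y / P ≤ 1 / P := by gcongr; exact hy01.2
    rw [abs_le]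
    constructor <;> linarith [h1.1, h1.2]
  rw [layer_apply ν k measurableSet_closedBall]
  have hsum : ∑ a ∈ Finset.range (T ^ k), ν (copyMap N T k a ⁻¹' Metric.closedBall x r)
      ≤ ENNReal.ofReal ((2 * (r + 1 / P) * g + 1) * m) := by
    rw [← Finset.sum_filter_add_sum_filter_not _ (fun a : ℕ => |a / g - x| ≤ r + 1 / P),
      Finset.sum_eq_zero (s := Finset.filter (fun a : ℕ => ¬ |a / g - x| ≤ r + 1 / P) _)
        (fun a ha => hzero a (Finset.mem_filter.mp ha).2), add_zero]
    refine (Finset.sum_le_sum fun a _ => hle a).trans ?_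
    rw [Finset.sum_const, nsmul_eq_mul, ← ENNReal.ofReal_natCast,
      ← ENNReal.ofReal_mul (by positivity)]
    refine ENNReal.ofReal_le_ofReal ?_
    gcongr
    exact card_filter_abs_sub_le _ g x _ hg0 (by positivity)
  calc _ ≤ ENNReal.ofReal (1 / (T : ℝ) ^ (2 * k))
        * ENNReal.ofReal ((2 * (r + 1 / P) * g + 1) * m) := by gcongr
    _ = ENNReal.ofReal (1 / (T : ℝ) ^ (2 * k) * ((2 * (r + 1 / P) * g + 1) * m)) :=
        (ENNReal.ofReal_mul (by positivity)).symm
    _ ≤ _ := ENNReal.ofReal_le_ofReal ?_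
  have hrα : 0 < r ^ α := by positivity
  have hgP1 : 1 / P * g ≤ 1 := by rw [one_div_mul_eq_div, div_le_one hP0]; exact hgP
  rcases le_total r (1 / P) with hcase | hcase
  · have h1 : 2 * (r + 1 / P) * g + 1 ≤ 5 := by nlinarith
    have h2 : m ≤ C * (r ^ α * T ^ (2 * k)) := by
      rw [← hPα, ← Real.mul_rpow hr.le hP0.le]
      exact min_le_right _ _
    calc 1 / (T : ℝ) ^ (2 * k) * ((2 * (r + 1 / P) * g + 1) * m)
        ≤ 1 / (T : ℝ) ^ (2 * k) * (5 * (C * (r ^ α * T ^ (2 * k)))) := by gcongr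
      _ = _ := by field_simp
  · have h1 : 2 * (r + 1 / P) * g + 1 ≤ 4 * r * g + 1 := by nlinarith
    have h2 : m ≤ 1 := min_le_left _ _
    have h3 : 1 / (T : ℝ) ^ (2 * k) * g ≤ 1 := by
      rw [one_div_mul_eq_div, div_le_one (by positivity), hg, pow_mul]
      gcongr
      nlinarith
    have h4 : 1 / (T : ℝ) ^ (2 * k) ≤ r ^ α := by
      rw [← hPα, one_div, ← Real.inv_rpow hP0.le, ← one_div]
      exact Real.rpow_le_rpow (by positivity) hcase hα0
    have h5 : r ≤ r ^ α := by
      conv_lhs => rw [← Real.rpow_one r]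
      exact Real.rpow_le_rpow_of_exponent_ge hr hr1 hα1
    calc 1 / (T : ℝ) ^ (2 * k) * ((2 * (r + 1 / P) * g + 1) * m)
        ≤ 1 / (T : ℝ) ^ (2 * k) * ((4 * r * g + 1) * 1) := by gcongr
      _ = 4 * r * (1 / (T : ℝ) ^ (2 * k) * g) + 1 / (T : ℝ) ^ (2 * k) := by ring
      _ ≤ 4 * r * 1 + r ^ α := by gcongr
      _ ≤ 5 * 1 * r ^ α := by linarith
      _ ≤ _ := by gcongr

include hT hTN in
theorem ballCondition_superposition (ν : Measure ℝ) [IsProbabilityMeasure ν]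
    (hν : ν (Set.Icc 0 1)ᶜ = 0)
    (α C : ℝ) (hα0 : 0 ≤ α) (hα1 : α ≤ 1) (hα : (N : ℝ) ^ α = T) (hC1 : 1 ≤ C)
    (hC : ∀ x r : ℝ, 0 < r → ν (Metric.closedBall x r) ≤ ENNReal.ofReal (C * r ^ α))
    (w : ℕ → ℝ) (hw : ∀ k, 0 < w k) (hws : Summable w)
    (hw1 : HasSum (fun k => w k / (T : ℝ) ^ k) 1) :
    BallCondition (superposition N T ν w) α := by
  have := isProbabilityMeasure_superposition (N := N) hT ν w hw hw1
  have hW : 0 ≤ ∑' k, w k := tsum_nonneg fun k => (hw k).le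
  refine ⟨1 + (∑' k, w k) * (5 * C), fun x r hr => ?_⟩
  have hrα : 0 < r ^ α := by positivity
  rcases le_total r 1 with hr1 | hr1
  · rw [superposition_apply ν w measurableSet_closedBall]
    calc _ ≤ ∑' k, ENNReal.ofReal (w k) * ENNReal.ofReal (5 * C * r ^ α) := by
          gcongr with k
          exact layer_closedBall_le hT hTN ν hν α C hα0 hα1 hα hC1 hC k x r hr hr1
      _ = ENNReal.ofReal ((∑' k, w k) * (5 * C * r ^ α)) := by
          rw [ENNReal.tsum_mul_right, ENNReal.ofReal_mul hW,
            ENNReal.ofReal_tsum_of_nonneg (fun k => (hw k).le) hws]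
      _ ≤ _ := ENNReal.ofReal_le_ofReal (by nlinarith)
  · refine prob_le_one.trans ?_
    rw [ENNReal.one_le_ofReal]
    have h1 := Real.one_le_rpow hr1 hα0
    have : 0 ≤ (∑' k, w k) * (5 * C) := by positivity
    nlinarith

/-! ### Fourier decay -/

theorem integrable_phase (μ : Measure ℝ) [IsFiniteMeasure μ] (ξ : ℝ) :
    Integrable (fun x => phase (x * ξ)) μ :=
  Integrable.of_bound
    (continuous_phase.comp (continuous_id.mul continuous_const)).aestronglyMeasurable 1
    (Eventually.of_forall fun _ => (norm_phase _).le)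

theorem integral_phase_layer (ν : Measure ℝ) [IsProbabilityMeasure ν] (k : ℕ) (ξ : ℝ) :
    ∫ x, phase (x * ξ) ∂layer N T ν k
      = (1 / (T : ℝ) ^ (2 * k)) • ∑ a ∈ Finset.range (T ^ k),
        phase (a / (2 * T : ℝ) ^ k * ξ) * ∫ y, phase (y * (ξ / (N : ℝ) ^ (2 * k))) ∂ν := by
  unfold layer
  rw [integral_smul_measure, ENNReal.toReal_ofReal (by positivity)]
  have hprob : ∀ a, IsProbabilityMeasure (ν.map (copyMap N T k a)) := fun a =>
    Measure.isProbabilityMeasure_map (measurable_copyMap N T k a).aemeasurable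
  rw [integral_finsetSum_measure fun a _ => integrable_phase _ ξ]
  congr 1
  refine Finset.sum_congr rfl fun a _ => ?_
  rw [integral_map (measurable_copyMap N T k a).aemeasurable
    (integrable_phase _ ξ).aestronglyMeasurable, ← integral_const_mul]
  refine integral_congr_ae (Eventually.of_forall fun y => ?_)
  simp only
  rw [← phase_add]
  congr 1
  unfold copyMap
  ring

include hT hTN in
-- No cancellation between copies is needed. The layer has mass `T ^ (-k)`, while rescaling the
-- decay of `ν` loses `N ^ (2k * β/2) ≤ N ^ (kα) = T ^ k`, and the two factors cancel.
theorem norm_integral_phase_layer_le (ν : Measure ℝ) [IsProbabilityMeasure ν]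
    (α β C : ℝ) (hα : (N : ℝ) ^ α = T) (hβ0 : 0 ≤ β) (hβ : β ≤ α)
    (hC : ∀ η : ℝ, ‖∫ x, phase (x * η) ∂ν‖ ≤ C * (1 + |η|) ^ (-β / 2)) (k : ℕ) (ξ : ℝ) :
    ‖∫ x, phase (x * ξ) ∂layer N T ν k‖ ≤ C * (1 + |ξ|) ^ (-β / 2) := by
  have hN1 : (1 : ℝ) ≤ N := by
    have : 1 ≤ N := by omega
    exact_mod_cast this
  have hN0 : (0 : ℝ) < N := by linarith
  have hT0 : (0 : ℝ) < T := by positivity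
  have hC0 : 0 ≤ C := by
    have := (norm_nonneg _).trans (hC 0)
    simpa using this
  set P : ℝ := (N : ℝ) ^ (2 * k) with hP
  have hP1 : 1 ≤ P := one_le_pow₀ hN1
  have hP0 : 0 < P := by linarith
  have hx := abs_nonneg ξ
  have hPβ : P ^ (β / 2) ≤ (T : ℝ) ^ k := by
    calc P ^ (β / 2) ≤ P ^ (α / 2) := Real.rpow_le_rpow_of_exponent_le hP1 (by linarith)
      _ = (T : ℝ) ^ k := by
        rw [hP, ← hα, ← Real.rpow_natCast, ← Real.rpow_natCast, ← Real.rpow_mul hN0.le,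
          ← Real.rpow_mul hN0.le]
        congr 1
        push_cast
        ring
  have hdecay : ‖∫ y, phase (y * (ξ / P)) ∂ν‖ ≤ C * ((1 + |ξ|) ^ (-β / 2) * (T : ℝ) ^ k) := by
    refine (hC _).trans ?_
    gcongr
    calc (1 + |ξ / P|) ^ (-β / 2) ≤ ((1 + |ξ|) / P) ^ (-β / 2) := by
          refine Real.rpow_le_rpow_of_nonpos (by positivity) ?_ (by linarith)
          rw [abs_div, abs_of_pos hP0, add_div]
          gcongr
          rw [div_le_one hP0]
          exact hP1
      _ = (1 + |ξ|) ^ (-β / 2) * P ^ (β / 2) := by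
          rw [Real.div_rpow (by positivity) hP0.le, neg_div 2 β, Real.rpow_neg hP0.le,
            div_inv_eq_mul]
      _ ≤ _ := by gcongr
  rw [integral_phase_layer, norm_smul, Real.norm_of_nonneg (by positivity)]
  have hsum : ‖∑ a ∈ Finset.range (T ^ k), phase (a / (2 * T : ℝ) ^ k * ξ)
      * ∫ y, phase (y * (ξ / P)) ∂ν‖ ≤ (T : ℝ) ^ k * (C * ((1 + |ξ|) ^ (-β / 2) * (T : ℝ) ^ k)) := by
    refine (norm_sum_le _ _).trans ?_
    refine (Finset.sum_le_sum (g := fun _ => C * ((1 + |ξ|) ^ (-β / 2) * (T : ℝ) ^ k))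
      fun a _ => ?_).trans ?_
    · rw [norm_mul, norm_phase, one_mul]
      exact hdecay
    · simp
  calc _ ≤ 1 / (T : ℝ) ^ (2 * k) * ((T : ℝ) ^ k * (C * ((1 + |ξ|) ^ (-β / 2) * (T : ℝ) ^ k))) := by
        gcongr
    _ = _ := by
        rw [two_mul, pow_add]
        field_simp

include hT hTN in
theorem fourierDecay_superposition (ν : Measure ℝ) [IsProbabilityMeasure ν] (α β : ℝ)
    (hα : (N : ℝ) ^ α = T) (hβ0 : 0 ≤ β) (hβ : β ≤ α) (hν : FourierDecay ν β)
    (w : ℕ → ℝ) (hw : ∀ k, 0 < w k) (hws : Summable w)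
    (hw1 : HasSum (fun k => w k / (T : ℝ) ^ k) 1) :
    FourierDecay (superposition N T ν w) β := by
  have := isProbabilityMeasure_superposition (N := N) hT ν w hw hw1
  obtain ⟨C, hC⟩ := hν
  refine ⟨(∑' k, w k) * C, fun ξ => ?_⟩
  have hsum := hasSum_integral_measure (integrable_phase (superposition N T ν w) ξ)
  rw [measureFourier_one_eq, superposition]
  rw [← hsum.tsum_eq]
  refine tsum_of_norm_bounded (g := fun k => w k * (C * (1 + |ξ|) ^ (-β / 2))) ?_ fun k => ?_
  · rw [mul_assoc]
    exact hws.hasSum.mul_right _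
  · rw [integral_smul_measure, norm_smul, ENNReal.toReal_ofReal (hw k).le,
      Real.norm_of_nonneg (hw k).le]
    gcongr
    · exact (hw k).le
    · refine norm_integral_phase_layer_le hT hTN ν α β C hα hβ0 hβ (fun η => ?_) k ξ
      rw [← measureFourier_one_eq]
      exact hC η

/-! ### The support -/

theorem isCompact_layerSet {K : Set ℝ} (hK : IsCompact K) (k : ℕ) :
    IsCompact (layerSet N T K k) :=
  (Finset.range (T ^ k)).isCompact_biUnion fun a _ => hK.image (continuous_copyMap N T k a)

include hT hTN in
-- The factor `2` in the spacing `(2T) ^ (-k)` confines the layer to `[0, 2 ^ (-k)]`. Hence the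
-- layers can accumulate only at `0`, and adjoining that point makes their union compact.
theorem layerSet_subset {K : Set ℝ} (hK : K ⊆ Set.Icc 0 1) (k : ℕ) :
    layerSet N T K k ⊆ Set.Icc 0 (1 / 2 ^ k) := by
  intro x hx
  simp only [layerSet, Set.mem_iUnion, Finset.mem_range] at hx
  obtain ⟨a, ha, y, hy, rfl⟩ := hx
  have hy' := hK hy
  have hT0 : (0 : ℝ) < T := by positivity
  have hN0 : (0 : ℝ) < N := by
    have : 0 < N := by omega
    exact_mod_cast this
  have hgP := two_mul_pow_le_pow hT hTN k
  have ha' : (a : ℝ) + 1 ≤ (T : ℝ) ^ k := by exact_mod_cast ha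
  unfold copyMap
  refine ⟨add_nonneg (by positivity) (div_nonneg hy'.1 (by positivity)), ?_⟩
  calc (a : ℝ) / (2 * T) ^ k + y / N ^ (2 * k) ≤ a / (2 * T) ^ k + 1 / (2 * T) ^ k := by
        gcongr
        exact hy'.2
    _ = (a + 1) / (2 * T) ^ k := (add_div _ _ _).symm
    _ ≤ T ^ k / (2 * T) ^ k := by gcongr
    _ = 1 / 2 ^ k := by rw [mul_pow]; field_simp

theorem isCompact_insert_iUnion {A : ℕ → Set ℝ} (hA : ∀ k, IsCompact (A k))
    (hA' : ∀ k, A k ⊆ Set.Icc 0 (1 / 2 ^ k)) : IsCompact (insert (0 : ℝ) (⋃ k, A k)) := by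
  have heq : insert (0 : ℝ) (⋃ k, A k)
      = ⋂ n : ℕ, (Set.Icc (0 : ℝ) (1 / 2 ^ n) ∪ ⋃ k ∈ Finset.range n, A k) := by
    ext x
    simp only [Set.mem_insert_iff, Set.mem_iUnion, Set.mem_iInter, Set.mem_union, Finset.mem_range]
    constructor
    · rintro (rfl | ⟨k, hk⟩) n
      · exact Or.inl ⟨le_rfl, by positivity⟩
      · rcases lt_or_ge k n with h | h
        · exact Or.inr ⟨k, h, hk⟩
        · refine Or.inl ⟨(hA' k hk).1, (hA' k hk).2.trans ?_⟩
          gcongr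
          norm_num
    · intro h
      by_contra! hcon
      have hI : ∀ n : ℕ, x ∈ Set.Icc (0 : ℝ) (1 / 2 ^ n) := fun n =>
        (h n).resolve_right fun ⟨k, _, hk⟩ => hcon.2 k hk
      have hlim : Tendsto (fun n : ℕ => (1 : ℝ) / 2 ^ n) atTop (𝓝 0) :=
        tendsto_const_nhds.div_atTop (tendsto_pow_atTop_atTop_of_one_lt one_lt_two)
      exact hcon.1 (le_antisymm (ge_of_tendsto' hlim fun n => (hI n).2) (hI 0).1)
  rw [heq]
  have hclosed : ∀ n : ℕ, IsClosed (Set.Icc (0 : ℝ) (1 / 2 ^ n) ∪ ⋃ k ∈ Finset.range n, A k) :=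
    fun n => isClosed_Icc.union (isClosed_biUnion_finset fun k _ => (hA k).isClosed)
  refine IsCompact.of_isClosed_subset (isCompact_Icc (a := (0 : ℝ)) (b := 1))
    (isClosed_iInter hclosed) fun x hx => ?_
  simpa using Set.mem_iInter.mp hx 0

theorem layer_compl_eq_zero (ν : Measure ℝ) {K : Set ℝ} (hKν : ν Kᶜ = 0) (k : ℕ) {E : Set ℝ}
    (hE : MeasurableSet E) (hKE : layerSet N T K k ⊆ E) : layer N T ν k Eᶜ = 0 := by
  rw [layer_apply ν k hE.compl, Finset.sum_eq_zero, mul_zero]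
  intro a ha
  refine measure_mono_null (t := Kᶜ) (fun y hy hyK => hy (hKE ?_)) hKν
  exact Set.mem_biUnion (Finset.mem_coe.mpr ha) (Set.mem_image_of_mem _ hyK)

theorem superposition_compl_eq_zero (ν : Measure ℝ) (w : ℕ → ℝ) {K : Set ℝ} (hKν : ν Kᶜ = 0)
    {E : Set ℝ} (hE : MeasurableSet E) (hKE : ∀ k, layerSet N T K k ⊆ E) :
    superposition N T ν w Eᶜ = 0 := by
  rw [superposition_apply ν w hE.compl]
  simp [layer_compl_eq_zero ν hKν _ hE (hKE _)]

theorem lipschitzWith_copyMap (N T k a : ℕ) :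
    LipschitzWith (1 / (N : ℝ≥0) ^ (2 * k)) (copyMap N T k a) := by
  refine LipschitzWith.of_dist_le_mul fun x y => le_of_eq ?_
  simp only [Real.dist_eq, copyMap]
  rw [add_sub_add_left_eq_sub, ← sub_div, abs_div]
  simp
  ring

theorem dimH_insert_iUnion_layerSet_le {K : Set ℝ} {d : ℝ≥0∞} (hK : dimH K ≤ d) :
    dimH (insert (0 : ℝ) (⋃ k, layerSet N T K k)) ≤ d := by
  rw [Set.insert_eq, dimH_union, dimH_singleton, dimH_iUnion]
  refine max_le bot_le (iSup_le fun k => ?_)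
  unfold layerSet
  rw [show (⋃ a ∈ Finset.range (T ^ k), copyMap N T k a '' K)
    = ⋃ a ∈ (Finset.range (T ^ k) : Set ℕ), copyMap N T k a '' K by simp only [Finset.mem_coe],
    dimH_bUnion (Finset.range (T ^ k)).countable_toSet]
  exact iSup₂_le fun a _ => ((lipschitzWith_copyMap N T k a).dimH_image_le K).trans hK

end Layer

/-- Mass distribution principle: a set of small diameter lies in a ball of comparable radius, so a
multiple of `μ` is dominated by `α`-dimensional Hausdorff measure. -/
theorem le_dimH_of_ballCondition (μ : Measure ℝ) (α : ℝ≥0) (hα : 0 < α)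
    (hμ : BallCondition μ α) (E : Set ℝ) (hE : μ E ≠ 0) : (α : ℝ≥0∞) ≤ dimH E := by
  obtain ⟨C, hC⟩ := hμ
  set C' : ℝ≥0 := max 1 C.toNNReal with hC'
  have hC'1 : 1 ≤ C' := le_max_left _ _
  have hCC' : C ≤ C' := by
    rw [hC', NNReal.coe_max]
    exact (Real.le_coe_toNNReal C).trans (le_max_right _ _)
  have hC'0 : (C' : ℝ≥0∞) ≠ 0 := by
    exact_mod_cast (zero_lt_one.trans_le hC'1).ne'
  have hαr : (0 : ℝ) < α := by exact_mod_cast hα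
  have hball : ∀ x r : ℝ, 0 < r → μ (Metric.closedBall x r) ≤ C' * ENNReal.ofReal r ^ (α : ℝ) := by
    intro x r hr
    refine (hC x r hr).trans ?_
    rw [ENNReal.ofReal_rpow_of_pos hr, ← ENNReal.ofReal_coe_nnreal,
      ← ENNReal.ofReal_mul C'.coe_nonneg]
    refine ENNReal.ofReal_le_ofReal ?_
    gcongr
  have hdiam : ∀ s : Set ℝ, Metric.ediam s ≤ 1 →
      ((C' : ℝ≥0∞)⁻¹ • μ) s ≤ Metric.ediam s ^ (α : ℝ) := by
    intro s hs
    rcases s.eq_empty_or_nonempty with rfl | ⟨x, hx⟩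
    · simp
    have hfin : Metric.ediam s ≠ ⊤ := ne_top_of_le_ne_top ENNReal.one_ne_top hs
    rw [Measure.smul_apply, smul_eq_mul, ENNReal.inv_mul_le_iff hC'0 ENNReal.coe_ne_top]
    have hsub : ∀ r : ℝ, (Metric.ediam s).toReal ≤ r → s ⊆ Metric.closedBall x r := by
      intro r hr y hy
      rw [Metric.mem_closedBall, dist_edist]
      exact (ENNReal.toReal_mono hfin (Metric.edist_le_ediam_of_mem hy hx)).trans hr
    have hle : ∀ r : ℝ, (Metric.ediam s).toReal < r → μ s ≤ C' * ENNReal.ofReal r ^ (α : ℝ) :=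
      fun r hr => (measure_mono (hsub r hr.le)).trans
        (hball x r (ENNReal.toReal_nonneg.trans_lt hr))
    -- The ball condition needs `r > 0` but the diameter may vanish, so it is applied to larger
    -- radii that decrease to the diameter.
    have hcont : Tendsto (fun r : ℝ => (C' : ℝ≥0∞) * ENNReal.ofReal r ^ (α : ℝ))
        (𝓝[>] (Metric.ediam s).toReal)
        (𝓝 (C' * ENNReal.ofReal (Metric.ediam s).toReal ^ (α : ℝ))) := by
      refine Tendsto.mono_left ?_ nhdsWithin_le_nhds
      refine ENNReal.Tendsto.const_mul ?_ (Or.inr ENNReal.coe_ne_top)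
      exact (ENNReal.continuous_rpow_const.comp ENNReal.continuous_ofReal).tendsto _
    rw [ENNReal.ofReal_toReal hfin] at hcont
    exact ge_of_tendsto hcont (eventually_mem_nhdsWithin.mono hle)
  have hle := Measure.le_hausdorffMeasure (α : ℝ) ((C' : ℝ≥0∞)⁻¹ • μ) 1 one_pos hdiam
  refine le_dimH_of_hausdorffMeasure_ne_zero fun h0 => hE ?_
  have h1 := hle E
  rw [h0, Measure.smul_apply, smul_eq_mul, nonpos_iff_eq_zero, mul_eq_zero] at h1
  exact h1.resolve_left (ENNReal.inv_ne_zero.mpr ENNReal.coe_ne_top)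

/-! ### Concentration of the Fourier transform -/

/-- The `k`-th progression of intervals. -/
def progression (N T k : ℕ) : Set ℝ := layerSet N T (Set.Icc 0 1) k

/-- Frequencies at which the `k`-th progression resonates. -/
noncomputable def resonantSet (N T k : ℕ) : Set ℝ :=
  ⋃ b ∈ Finset.range (⌊((N : ℝ) ^ 2 / (2 * T)) ^ k / 32⌋₊ + 1),
    Set.Icc (b * (2 * T : ℝ) ^ k) (b * (2 * T : ℝ) ^ k + 2 ^ k / 16)

theorem measureFourier_indicator_eq (μ : Measure ℝ) {F : Set ℝ} (hF : MeasurableSet F) (ξ : ℝ) :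
    measureFourier μ (F.indicator fun _ => 1) ξ = ∫ x in F, phase (x * ξ) ∂μ := by
  rw [measureFourier_apply, ← integral_indicator hF]
  refine integral_congr_ae (Eventually.of_forall fun x => ?_)
  by_cases hx : x ∈ F
  · simp only [Set.indicator_of_mem hx, phase, mul_one]
    congr 1
    push_cast
    ring
  · simp only [Set.indicator_of_notMem hx, mul_zero]

theorem le_norm_measureFourier_indicator (μ : Measure ℝ) [IsFiniteMeasure μ] {F : Set ℝ}
    (hF : MeasurableSet F) (ξ : ℝ) (h : ∀ x ∈ F, 1 / 2 ≤ (phase (x * ξ)).re) :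
    μ.real F / 2 ≤ ‖measureFourier μ (F.indicator fun _ => 1) ξ‖ := by
  have hint : Integrable (fun x => phase (x * ξ)) (μ.restrict F) := integrable_phase _ ξ
  rw [measureFourier_indicator_eq μ hF]
  refine le_trans ?_ (Complex.re_le_norm _)
  have hre : (∫ x in F, phase (x * ξ) ∂μ).re = ∫ x in F, (phase (x * ξ)).re ∂μ :=
    (integral_re hint).symm
  rw [hre]
  calc μ.real F / 2 = ∫ _x in F, (1 / 2 : ℝ) ∂μ := by
        rw [setIntegral_const, smul_eq_mul]; ring
    _ ≤ _ := setIntegral_mono_on (integrable_const _) hint.re hF h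

theorem half_le_phase_re (n : ℕ) (θ : ℝ) (h0 : 0 ≤ θ) (h1 : θ ≤ 1 / 6) :
    1 / 2 ≤ (phase (n + θ)).re := by
  have h : phase (n + θ) = phase θ := by
    rw [phase_add, show (n : ℝ) = ((n : ℤ) : ℝ) by simp, phase_intCast, one_mul]
  have hpi := Real.pi_pos
  rw [h, phase_re, ← Real.cos_pi_div_three]
  exact Real.cos_le_cos_of_nonneg_of_le_pi (by positivity) (by linarith) (by nlinarith)

section Resonance

variable {N T : ℕ} (hT : 2 ≤ T) (hTN : T < N)

include hT hTN in
-- For `x = a/g + y/P` and `ξ = b*g + s`, with `g = (2T) ^ k` and `P = N ^ (2k)`, the product is the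
-- integer `a*b` plus `(a/g)*s + (y/P)*ξ`. The two remainders are nonnegative and at most `1/16` and
-- `3/32`, together less than `1/6`.
theorem half_le_phase_re_of_mem (k : ℕ) {x ξ : ℝ} (hx : x ∈ progression N T k)
    (hξ : ξ ∈ resonantSet N T k) : 1 / 2 ≤ (phase (x * ξ)).re := by
  have hT0 : (0 : ℝ) < T := by positivity
  have hN2 : 2 ≤ N := by omega
  have hN2' : (2 : ℝ) ≤ N := by exact_mod_cast hN2
  have hN0 : (0 : ℝ) < N := by linarith
  simp only [progression, layerSet, Set.mem_iUnion, Finset.mem_range] at hx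
  simp only [resonantSet, Set.mem_iUnion, Finset.mem_range] at hξ
  obtain ⟨a, ha, y, hy, rfl⟩ := hx
  obtain ⟨b, hb, hξ1, hξ2⟩ := hξ
  have ha' : (a : ℝ) ≤ (T : ℝ) ^ k := by exact_mod_cast ha.le
  have hb' : (b : ℝ) ≤ ((N : ℝ) ^ 2 / (2 * T)) ^ k / 32 := by
    refine le_trans ?_ (Nat.floor_le (by positivity))
    exact_mod_cast Nat.lt_succ_iff.mp hb
  set P : ℝ := (N : ℝ) ^ (2 * k) with hP
  have hP0 : 0 < P := by positivity
  set g : ℝ := (2 * T : ℝ) ^ k with hg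
  have hg0 : 0 < g := by positivity
  obtain ⟨s, rfl⟩ : ∃ s, ξ = b * g + s := ⟨ξ - b * g, by ring⟩
  have hs0 : 0 ≤ s := by linarith
  have hs1 : s ≤ 2 ^ k / 16 := by linarith
  have hξ0 : 0 ≤ b * g + s := by positivity
  have h2P : (2 : ℝ) ^ k ≤ P := by
    calc (2 : ℝ) ^ k ≤ (N : ℝ) ^ k := by gcongr
      _ ≤ P := pow_le_pow_right₀ (by linarith) (by omega)
  have hbg : b * g ≤ P / 32 := by
    calc b * g ≤ ((N : ℝ) ^ 2 / (2 * T)) ^ k / 32 * g := by gcongr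
      _ = P / 32 := by rw [hP, hg, div_pow, pow_mul]; field_simp
  have hag : (a : ℝ) / g * s ≤ 1 / 16 := by
    calc (a : ℝ) / g * s ≤ (T : ℝ) ^ k / g * (2 ^ k / 16) := by gcongr
      _ = 1 / 16 := by rw [hg, mul_pow]; field_simp
  have hyξ : y / P * (b * g + s) ≤ 3 / 32 := by
    calc y / P * (b * g + s) ≤ 1 / P * (P / 32 + P / 16) := by
          have := hy.1
          have := hy.2
          gcongr
          linarith
      _ = 3 / 32 := by field_simp; norm_num
  have heq : copyMap N T k a y * (b * g + s)
      = ((a * b : ℕ) : ℝ) + (a / g * s + y / P * (b * g + s)) := by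
    simp only [copyMap]
    push_cast
    field_simp
    ring
  rw [heq]
  refine half_le_phase_re _ _ ?_ (by linarith)
  have := hy.1
  positivity

theorem measurableSet_resonantSet (k : ℕ) : MeasurableSet (resonantSet N T k) :=
  (Finset.range _).measurableSet_biUnion fun _ _ => measurableSet_Icc

include hT in
-- The intervals are disjoint, since their length `2 ^ k / 16` is below the spacing `(2T) ^ k`.
-- Including both `b = 0` and the floor itself makes their number at least `(N² / (2T)) ^ k / 32`,
-- and `512 = 32 * 16`.
theorem le_volume_resonantSet (k : ℕ) :
    ENNReal.ofReal (((N : ℝ) ^ 2 / T) ^ k / 512) ≤ volume (resonantSet N T k) := by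
  have hT2 : (2 : ℝ) ≤ T := by exact_mod_cast hT
  have hT0 : (0 : ℝ) < T := by linarith
  have hlt : (2 : ℝ) ^ k / 16 < (2 * T : ℝ) ^ k := by
    have h1 : (2 : ℝ) ^ k ≤ (2 * T : ℝ) ^ k := by gcongr; linarith
    have h2 : (0 : ℝ) < 2 ^ k := by positivity
    linarith
  have hdisj : ∀ b c : ℕ, b < c → Disjoint
      (Set.Icc (b * (2 * T : ℝ) ^ k) (b * (2 * T : ℝ) ^ k + 2 ^ k / 16))
      (Set.Icc (c * (2 * T : ℝ) ^ k) (c * (2 * T : ℝ) ^ k + 2 ^ k / 16)) := by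
    intro b c hbc
    have hbc' : (b : ℝ) + 1 ≤ c := by exact_mod_cast hbc
    refine Set.disjoint_left.mpr fun x hx hx' => ?_
    have h1 := hx.2
    have h2 := hx'.1
    have h3 : ((b : ℝ) + 1) * (2 * T : ℝ) ^ k ≤ c * (2 * T : ℝ) ^ k := by gcongr
    linarith
  rw [resonantSet, measure_biUnion_finset ?_ fun _ _ => measurableSet_Icc]
  · simp only [Real.volume_Icc, add_sub_cancel_left, Finset.sum_const, Finset.card_range,
      nsmul_eq_mul]
    rw [← ENNReal.ofReal_natCast, ← ENNReal.ofReal_mul (by positivity)]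
    refine ENNReal.ofReal_le_ofReal ?_
    have h1 := (Nat.lt_floor_add_one (((N : ℝ) ^ 2 / (2 * T)) ^ k / 32)).le
    calc ((N : ℝ) ^ 2 / T) ^ k / 512 = ((N : ℝ) ^ 2 / (2 * T)) ^ k / 32 * (2 ^ k / 16) := by
          rw [div_pow, div_pow, mul_pow]
          field_simp
          ring
      _ ≤ _ := by
          push_cast
          gcongr
  · intro b _ c _ hbc
    rcases lt_or_gt_of_ne hbc with h | h
    · exact hdisj b c h
    · exact (hdisj c b h).symm

theorem measurableSet_progression (k : ℕ) : MeasurableSet (progression N T k) :=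
  (isCompact_layerSet isCompact_Icc k).measurableSet

include hT hTN in
theorem progression_subset (k : ℕ) : progression N T k ⊆ Set.Icc 0 1 :=
  (layerSet_subset hT hTN subset_rfl k).trans
    (Set.Icc_subset_Icc_right (div_le_one_of_le₀ (one_le_pow₀ one_le_two) (by positivity)))

theorem isFiniteUnionOfIntervals_progression (k : ℕ) :
    IsFiniteUnionOfIntervals (progression N T k) := by
  refine ⟨(fun a => copyMap N T k a '' Set.Icc 0 1) '' (Finset.range (T ^ k) : Set ℕ),
    (Finset.range (T ^ k)).finite_toSet.image _, ?_, ?_⟩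
  · rintro _ ⟨a, -, rfl⟩
    exact (isPreconnected_Icc.image _ (continuous_copyMap N T k a).continuousOn).ordConnected
  · rw [Set.sUnion_image]
    rfl

include hT in
theorem le_superposition_progression (ν : Measure ℝ) [IsProbabilityMeasure ν]
    (hν : ν (Set.Icc 0 1)ᶜ = 0) (w : ℕ → ℝ) (hw : ∀ k, 0 < w k) (k : ℕ) :
    ENNReal.ofReal (w k / (T : ℝ) ^ k) ≤ superposition N T ν w (progression N T k) := by
  rw [superposition_apply ν w (measurableSet_progression k)]
  refine le_trans (le_of_eq ?_) (ENNReal.le_tsum k)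
  rw [layer_eq_of_preimage hT ν k (measurableSet_progression k), ← ENNReal.ofReal_mul (hw k).le,
    mul_one_div]
  intro a ha
  refine le_antisymm prob_le_one ?_
  have hfull : ν (Set.Icc 0 1) = 1 := (prob_compl_eq_zero_iff measurableSet_Icc).mp hν
  rw [← hfull]
  exact measure_mono fun y hy =>
    Set.mem_biUnion (Finset.mem_coe.mpr ha) (Set.mem_image_of_mem _ hy)

end Resonance

/-- On `G` the transform is at least `μ F / 2`, while the `L²` norm is `√(μ F)`. The quotient is
increasing in `μ F`, so a lower bound on the mass of `F` is enough and the other layers may add to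
it freely. -/
theorem le_eLpNorm_div_eLpNorm (μ : Measure ℝ) [IsProbabilityMeasure μ] {F G : Set ℝ}
    (hF : MeasurableSet F) (hG : MeasurableSet G)
    (hFG : ∀ x ∈ F, ∀ ξ ∈ G, 1 / 2 ≤ (phase (x * ξ)).re) (p m v : ℝ) (hp : 0 < p) (hm : 0 < m)
    (hv : 0 ≤ v) (hmF : ENNReal.ofReal m ≤ μ F) (hvG : ENNReal.ofReal v ≤ volume G) :
    ENNReal.ofReal (√m * v ^ (1 / p) / 2)
      ≤ eLpNorm (measureFourier μ (F.indicator fun _ => (1 : ℂ))) (ENNReal.ofReal p) volume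
        / eLpNorm (F.indicator fun _ => (1 : ℂ)) 2 μ := by
  have hmF' : m ≤ μ.real F := (ENNReal.ofReal_le_iff_le_toReal (measure_ne_top _ _)).mp hmF
  have hF0 : 0 < μ.real F := hm.trans_le hmF'
  have hden : eLpNorm (F.indicator fun _ => (1 : ℂ)) 2 μ = ENNReal.ofReal √(μ.real F) := by
    rw [eLpNorm_indicator_const hF two_ne_zero ENNReal.ofNat_ne_top, enorm_one, one_mul,
      ← ofReal_measureReal, ENNReal.ofReal_rpow_of_pos hF0, Real.sqrt_eq_rpow]
    simp
  have hnum : ENNReal.ofReal (μ.real F / 2 * v ^ (1 / p))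
      ≤ eLpNorm (measureFourier μ (F.indicator fun _ => (1 : ℂ))) (ENNReal.ofReal p) volume := by
    calc ENNReal.ofReal (μ.real F / 2 * v ^ (1 / p))
        = ENNReal.ofReal (μ.real F / 2) * ENNReal.ofReal v ^ (1 / p) := by
          rw [ENNReal.ofReal_mul (by positivity),
            ENNReal.ofReal_rpow_of_nonneg hv (by positivity)]
      _ ≤ ENNReal.ofReal (μ.real F / 2) * volume G ^ (1 / p) := by gcongr
      _ = eLpNorm (G.indicator fun _ => μ.real F / 2) (ENNReal.ofReal p) volume := by
          rw [eLpNorm_indicator_const hG (by simpa using hp) ENNReal.ofReal_ne_top,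
            ENNReal.toReal_ofReal hp.le, Real.enorm_of_nonneg (by positivity)]
      _ ≤ _ := by
          refine eLpNorm_mono fun ξ => ?_
          by_cases hξ : ξ ∈ G
          · rw [Set.indicator_of_mem hξ, Real.norm_of_nonneg (by positivity)]
            exact le_norm_measureFourier_indicator μ hF ξ fun x hx => hFG x hx ξ hξ
          · rw [Set.indicator_of_notMem hξ, norm_zero]
            exact norm_nonneg _
  rw [hden, ENNReal.le_div_iff_mul_le (Or.inl (by simpa using hF0)) (Or.inl ENNReal.ofReal_ne_top),
    ← ENNReal.ofReal_mul (by positivity)]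
  refine le_trans (ENNReal.ofReal_le_ofReal ?_) hnum
  have h1 : √m ≤ √(μ.real F) := Real.sqrt_le_sqrt hmF'
  have h2 := Real.mul_self_sqrt hF0.le
  calc √m * v ^ (1 / p) / 2 * √(μ.real F) ≤ √(μ.real F) * v ^ (1 / p) / 2 * √(μ.real F) := by gcongr
    _ = √(μ.real F) * √(μ.real F) / 2 * v ^ (1 / p) := by ring
    _ = _ := by rw [h2]

/-! ### Conclusion -/

/-- The weights must be summable for the uniform layer estimates, yet decay subexponentially so as
not to spoil the exponential growth of the ratio. The constant `c` normalises the total mass. -/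
theorem exists_weights (T : ℕ) (hT : 2 ≤ T) :
    ∃ (w : ℕ → ℝ) (c : ℝ), (∀ k, 0 < w k) ∧ Summable w ∧
      HasSum (fun k => w k / (T : ℝ) ^ k) 1 ∧ 0 < c ∧ ∀ k, w k = c / ((k : ℝ) + 1) ^ 2 := by
  have hT1 : (1 : ℝ) ≤ T := by exact_mod_cast (by omega : 1 ≤ T)
  have hs : Summable fun k : ℕ => 1 / ((k : ℝ) + 1) ^ 2 := by
    have := (summable_nat_add_iff 1).mpr (Real.summable_one_div_nat_pow.mpr one_lt_two)
    simpa using this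
  have hs' : Summable fun k : ℕ => 1 / ((k : ℝ) + 1) ^ 2 / (T : ℝ) ^ k := by
    refine hs.of_nonneg_of_le (fun k => by positivity) fun k => ?_
    exact div_le_self (by positivity) (one_le_pow₀ hT1)
  set Z : ℝ := ∑' k : ℕ, 1 / ((k : ℝ) + 1) ^ 2 / (T : ℝ) ^ k with hZ
  have hZ0 : 0 < Z := hs'.tsum_pos (fun k => by positivity) 0 (by simp)
  refine ⟨fun k => Z⁻¹ / ((k : ℝ) + 1) ^ 2, Z⁻¹, fun k => by positivity, ?_, ?_,
    inv_pos.mpr hZ0, fun k => rfl⟩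
  · refine (hs.mul_left Z⁻¹).congr fun k => ?_
    rw [mul_one_div]
  · have := hs'.hasSum.mul_left Z⁻¹
    rw [← hZ, inv_mul_cancel₀ hZ0.ne'] at this
    refine this.congr_fun fun k => ?_
    field_simp

theorem tendsto_pow_div_add_one_atTop (ρ : ℝ) (hρ : 1 < ρ) :
    Tendsto (fun k : ℕ => ρ ^ k / ((k : ℝ) + 1)) atTop atTop := by
  have h1 := (tendsto_add_atTop_iff_nat 1).mpr (tendsto_pow_const_div_const_pow_of_one_lt 1 hρ)
  have h2 : Tendsto (fun k : ℕ => ((k : ℝ) + 1) / ρ ^ k) atTop (𝓝 0) := by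
    have := h1.mul_const ρ
    rw [zero_mul] at this
    refine this.congr fun k => ?_
    push_cast
    rw [pow_succ ρ k]
    field_simp
  have h3 : Tendsto (fun k : ℕ => ((k : ℝ) + 1) / ρ ^ k) atTop (𝓝[>] 0) :=
    tendsto_nhdsWithin_iff.mpr ⟨h2, Eventually.of_forall fun k => by
      simp only [Set.mem_Ioi]; positivity⟩
  refine h3.inv_tendsto_nhdsGT_zero.congr fun k => ?_
  simp [inv_div]

/-- As a power of `N` the quantity has exponent `(2 - α)/p - α/2`, positive exactly when `p < 4/α -
2`. This is the only place where the size of `p` matters. -/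
theorem one_lt_growth {N T : ℕ} (hN : 1 < N) (α p : ℝ) (hα0 : 0 < α)
    (hα : (N : ℝ) ^ α = T) (hp1 : 1 ≤ p) (hp : p < 4 / α - 2) :
    1 < ((N : ℝ) ^ 2 / T) ^ (1 / p) / √T := by
  have hN' : (1 : ℝ) < N := by exact_mod_cast hN
  have hN0 : (0 : ℝ) < N := by linarith
  have hp0 : 0 < p := by linarith
  have hlt : α * p < 2 * (2 - α) := by
    have := mul_lt_mul_of_pos_left hp hα0
    rw [mul_sub, mul_div_cancel₀ _ hα0.ne'] at this
    linarith
  rw [← hα, Real.sqrt_eq_rpow, ← Real.rpow_natCast, ← Real.rpow_sub hN0, ← Real.rpow_mul hN0.le,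
    ← Real.rpow_mul hN0.le, ← Real.rpow_sub hN0]
  refine Real.one_lt_rpow hN' ?_
  push_cast
  rw [mul_one_div, mul_one_div, sub_pos, div_lt_div_iff₀ two_pos hp0]
  linarith

theorem tendsto_lower_bound {N T : ℕ} (hT : 0 < T) (p c : ℝ) (hc : 0 < c)
    (hρ : 1 < ((N : ℝ) ^ 2 / T) ^ (1 / p) / √T) :
    Tendsto (fun k : ℕ => √(c / ((k : ℝ) + 1) ^ 2 / (T : ℝ) ^ k)
      * (((N : ℝ) ^ 2 / T) ^ k / 512) ^ (1 / p) / 2) atTop atTop := by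
  have hT0 : (0 : ℝ) < T := by exact_mod_cast hT
  have hconst : 0 < √c / 512 ^ (1 / p) / 2 := by positivity
  refine ((tendsto_pow_div_add_one_atTop _ hρ).const_mul_atTop hconst).congr fun k => ?_
  have hb : (0 : ℝ) ≤ (N : ℝ) ^ 2 / T := by positivity
  have hpow : √((T : ℝ) ^ k) = √(T : ℝ) ^ k := by
    rw [Real.sqrt_eq_iff_mul_self_eq (by positivity) (by positivity), ← mul_pow,
      Real.mul_self_sqrt hT0.le]
  rw [Real.sqrt_div (by positivity), Real.sqrt_div hc.le, Real.sqrt_sq (by positivity), hpow,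
    div_pow _ √(T : ℝ), Real.rpow_pow_comm hb, Real.div_rpow (by positivity) (by norm_num)]
  field_simp

theorem exists_two_le_lt_rpow_eq (α : ℝ) (hα0 : 0 < α) (hα1 : α < 1) (t n : ℕ) (hn : n ≠ 1)
    (h : α = Real.log t / Real.log n) : 2 ≤ t ∧ t < n ∧ (n : ℝ) ^ α = t := by
  have hn0 : n ≠ 0 := by
    -- The convention `log 0 = 0` would force `α = 0`.
    rintro rfl
    simp at h
    exact hα0.ne' h
  have hn2 : (1 : ℝ) < n := by
    have : 1 < n := by omega
    exact_mod_cast this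
  have hlog : 0 < Real.log n := Real.log_pos hn2
  have hlt : Real.log t = α * Real.log n := by rw [h, div_mul_cancel₀ _ hlog.ne']
  have htpos : 0 < Real.log t := by rw [hlt]; positivity
  have ht2 : 2 ≤ t := by
    by_contra! hcon
    interval_cases t <;> simp at htpos
  have ht0 : (0 : ℝ) < t := by positivity
  refine ⟨ht2, ?_, ?_⟩
  · have : Real.log t < Real.log n := by rw [hlt]; nlinarith
    exact_mod_cast (Real.log_lt_log_iff ht0 (by linarith)).mp this
  · rw [Real.rpow_def_of_pos (by linarith), mul_comm, ← hlt, Real.exp_log ht0]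

theorem not_restrictionEstimate_of_tendsto (μ : Measure ℝ) [IsFiniteMeasure μ] (p : ℝ)
    (F : ℕ → Set ℝ) (hF : ∀ k, MeasurableSet (F k))
    (hlim : Tendsto (fun k => eLpNorm (measureFourier μ ((F k).indicator fun _ => (1 : ℂ)))
      (ENNReal.ofReal p) volume / eLpNorm ((F k).indicator fun _ => (1 : ℂ)) 2 μ) atTop (𝓝 ∞)) :
    ¬ RestrictionEstimate μ p := by
  rintro ⟨C, hC⟩
  obtain ⟨k, hk⟩ := (hlim.eventually (lt_mem_nhds (ENNReal.coe_lt_top (r := C)))).exists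
  refine absurd hk (not_lt.mpr (ENNReal.div_le_of_le_mul (hC _ ?_)))
  exact memLp_indicator_const 2 (hF k) 1 (Or.inr (measure_ne_top _ _))

theorem theorem2 (α : ℝ) (hα0 : 0 < α) (hα1 : α < 1)
    (hα : ∃ t₀ n₀ : ℕ, n₀ ≠ 1 ∧ α = Real.log t₀ / Real.log n₀)
    (p : ℝ) (hp1 : 1 ≤ p) (hp : p < 4 / α - 2) :
    ∃ (μ : Measure ℝ) (E : Set ℝ) (F : ℕ → Set ℝ),
      IsProbabilityMeasure μ ∧
      IsCompact E ∧ E ⊆ Set.Icc 0 1 ∧ μ Eᶜ = 0 ∧ dimH E = ENNReal.ofReal α ∧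
      BallCondition μ α ∧
      (∀ β : ℝ, β < α → FourierDecay μ β) ∧
      (∀ ℓ : ℕ, F ℓ ⊆ Set.Icc 0 1 ∧ IsFiniteUnionOfIntervals (F ℓ)) ∧
      (∀ ℓ : ℕ, eLpNorm ((F ℓ).indicator (fun _ => (1 : ℂ))) 2 μ ≠ 0) ∧
      Tendsto (fun ℓ : ℕ =>
        eLpNorm (measureFourier μ ((F ℓ).indicator (fun _ => (1 : ℂ))))
            (ENNReal.ofReal p) volume
          / eLpNorm ((F ℓ).indicator (fun _ => (1 : ℂ))) 2 μ) atTop (𝓝 ∞) ∧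
      ¬ RestrictionEstimate μ p := by
  obtain ⟨T, N, hN1, hαTN⟩ := hα
  obtain ⟨hT, hTN, hNα⟩ := exists_two_le_lt_rpow_eq α hα0 hα1 T N hN1 hαTN
  have hN : 1 < N := by omega
  have hT0 : (0 : ℝ) < T := by positivity
  obtain ⟨ν, K, hνprob, hK, hK01, hνK, hKdim, hνball, hνdecay⟩ :=
    exists_salem_measure N T (by omega) hTN ⟨α, hα0.le⟩ (by exact_mod_cast hα1) hNα
  obtain ⟨w, c, hw, hws, hw1, hc, hwc⟩ := exists_weights T hT
  have hν01 : ν (Set.Icc 0 1)ᶜ = 0 := measure_mono_null (Set.compl_subset_compl.mpr hK01) hνK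
  set μ := superposition N T ν w with hμ
  have hμprob : IsProbabilityMeasure μ := isProbabilityMeasure_superposition hT ν w hw hw1
  set E : Set ℝ := insert 0 (⋃ k, layerSet N T K k) with hE
  have hEc : IsCompact E :=
    isCompact_insert_iUnion (isCompact_layerSet hK) (layerSet_subset hT hTN hK01)
  have hμE : μ Eᶜ = 0 := superposition_compl_eq_zero ν w hνK hEc.measurableSet fun k =>
    (Set.subset_iUnion _ k).trans (Set.subset_insert _ _)
  have hball : BallCondition μ α := by
    refine ballCondition_superposition hT hTN ν hν01 α (4 * T) hα0.le hα1.le hNα ?_ hνball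
      w hw hws hw1
    have : (2 : ℝ) ≤ T := by exact_mod_cast hT
    linarith
  have hmass : ∀ k, ENNReal.ofReal (w k / (T : ℝ) ^ k) ≤ μ (progression N T k) :=
    le_superposition_progression hT ν hν01 w hw
  have hratio : Tendsto (fun k : ℕ =>
      eLpNorm (measureFourier μ ((progression N T k).indicator (fun _ => (1 : ℂ))))
          (ENNReal.ofReal p) volume
        / eLpNorm ((progression N T k).indicator (fun _ => (1 : ℂ))) 2 μ) atTop (𝓝 ∞) := by
    refine tendsto_nhds_top_mono (ENNReal.tendsto_ofReal_nhds_top.mpr (tendsto_lower_bound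
      (N := N) (T := T) (by omega) p c hc (one_lt_growth hN α p hα0 hNα hp1 hp)))
      (Eventually.of_forall fun k => ?_)
    simp only
    rw [← hwc]
    exact le_eLpNorm_div_eLpNorm μ (measurableSet_progression k) (measurableSet_resonantSet k)
      (fun x hx ξ hξ => half_le_phase_re_of_mem hT hTN k hx hξ) p _ _ (by linarith)
      (div_pos (hw k) (by positivity)) (by positivity) (hmass k) (le_volume_resonantSet hT k)
  refine ⟨μ, E, progression N T, hμprob, hEc, ?_, hμE, le_antisymm ?_ ?_, hball, fun β hβ => ?_,
    fun k => ⟨progression_subset hT hTN k, isFiniteUnionOfIntervals_progression k⟩, fun k => ?_,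
    hratio, not_restrictionEstimate_of_tendsto μ p _ measurableSet_progression hratio⟩
  · refine Set.insert_subset (by simp) (Set.iUnion_subset fun k => ?_)
    exact (layerSet_subset hT hTN hK01 k).trans
      (Set.Icc_subset_Icc_right (div_le_one_of_le₀ (one_le_pow₀ one_le_two) (by positivity)))
  · refine dimH_insert_iUnion_layerSet_le (hKdim.trans (le_of_eq ?_))
    exact (ENNReal.ofReal_eq_coe_nnreal hα0.le).symm
  · rw [ENNReal.ofReal_eq_coe_nnreal hα0.le]
    refine le_dimH_of_ballCondition μ ⟨α, hα0.le⟩ hα0 hball E ?_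
    rw [(prob_compl_eq_zero_iff hEc.measurableSet).mp hμE]
    exact one_ne_zero
  -- The claim includes negative `β`, for which `|μ̂| ≤ 1` already suffices.
  · rcases le_total β 0 with h | h
    · exact fourierDecay_of_nonpos μ β h
    · exact fourierDecay_superposition hT hTN ν α β hNα h hβ.le (hνdecay β h hβ) w hw hws hw1
  · have hpos : μ (progression N T k) ≠ 0 := by
      refine (lt_of_lt_of_le ?_ (hmass k)).ne'
      exact ENNReal.ofReal_pos.mpr (div_pos (hw k) (by positivity))
    rw [eLpNorm_indicator_const (measurableSet_progression k) two_ne_zero ENNReal.ofNat_ne_top,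
      enorm_one, one_mul]
    simp [hpos]
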